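/- **Setting.** Let $\mathcal V=\{1,\dots,N\}$ be a set of agents. Agent $i$ has a state space $\mathcal S_i$, an action space $\mathcal A_i$ and a policy parameter $\theta_i\in\mathbb R^{d_i}$; write $\theta=(\theta_1,\dots,\theta_N)\in\mathbb R^d$ with $d=\sum_i d_i\ge 1$. Let $\mathcal E_S,\mathcal E_O,\mathcal E_R\subseteq\mathcal V\times\mathcal V$ be directed edge sets, and for $X\in\{S,O,R\}$ put $\mathcal I^X_i=\{j:(j,i)\in\mathcal E_X\}\cup\{i\}$. At each time $t$, given the joint state $s(t)$, the agents draw their actions independently, $a_i(t)\sim\pi_i^{\theta_i}(\cdot\mid s_{\mathcal I_i^O}(t))$; then the next states are drawn independently, $s_i(t+1)\sim\mathcal P_i(\cdot\mid s_{\mathcal I_i^S}(t),a_{\mathcal I_i^S}(t))$. Agent $i$ receives the reward $r_i(t)=r_i(s_{\mathcal I_i^R}(t),a_{\mathcal I_i^R}(t))$. Let $\gamma\in(0,1)$, let $\mathcal D$ be the distribution of $s(0)$, and define $$V_i^{\pi(\theta)}(s)=\mathbb E\Big[\sum_{t\ge0}\gamma^t r_i(t)\,\Big|\,s(0)=s\Big],\quad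 J(\theta)=\mathbb E_{s\sim\mathcal D}\Big[\mathbb E\Big[\sum_{t\ge 0}\gamma^t\sum_i r_i(t)\,\Big|\,s(0)=s\Big]\Big],\quad J^\delta(\theta)=\mathbb E_{u\sim\mathcal N(0,I_d)}J(\theta+\delta u).$$ Let $\mathcal R_i$ consist of $i$ and all agents reachable from $i$ along $\mathcal E_S\cup\mathcal E_O$, and let $\mathcal I_i^L=\{j:\mathcal I_j^R\cap\mathcal R_i\ne\varnothing\}$ be the group of agents in the local value function of agent $i$. The clusters $l\in\mathcal C$ are the maximal strongly connected components of $(\mathcal V,\mathcal E_S\cup\mathcal E_O)$; write $l_i$ for the cluster of $i$. All $i$ in cluster $l$ have the same $\mathcal I_i^L$, denoted $\mathcal I_l^{cl}$; put $n_l=|\mathcal I_l^{cl}|$ and $n_0=\max_l n_l$. **Assumptions.** (a) $|V_i^{\pi(\theta)}(s)-V_i^{\pi(\theta')}(s)|\le L_i\|\theta-\theta'\|$ for all $i,s,\theta,\theta'$; put $L=\sum_iL_i$, and let $L>0$. (b) The communication graph is undirected, and each $\mathcal I_l^{cl}$ induces a connected subgraph of it. (c) For each cluster $l$ there is a weight matrix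 $C^l\in\mathbb R^{N\times N}$ with $C^l_{ij}>0$ if $i,j\in\mathcal I_l^{cl}$ and $i,j$ are equal or adjacent in the communication graph, with all other off-diagonal entries equal to $0$, and such that its principal submatrix $C^l_0$ on $\mathcal I_l^{cl}$ is doubly stochastic. Put $\rho_l=\|C_0^l-\frac1{n_l}\mathbf 1\mathbf 1^\top\|$ (spectral norm) and $\rho_0=\max_l\rho_l$. (d) $r_l\le r_i\le r_u$ for all $i$, with constants $r_l,r_u$. Put $J_l=\frac{r_l}{1-\gamma}$, $J_u=\frac{r_u}{1-\gamma}$, $J_0=\max\{|J_l|,|J_u|\}$. **Algorithm.** Fix $K\ge1$, $T_e$, $T_c$, $\delta$, $\eta$ and $\theta^0\in\mathbb R^d$. In epoch $k=0,1,\dots$, draw $u^k\sim\mathcal N(0,I_d)$ and $s(0)\sim\mathcal D$ afresh, run the policy with parameter $\theta^k+\delta u^k$ for $T_e$ steps, and let $W_i=\sum_{t=0}^{T_e-1}\gamma^tr_i(t)$. For each cluster $l$ set $\mu_i^{l}(0)=W_i$ if $i\in\mathcal I_l^{cl}$ and $\mu_i^l(0)=0$ otherwise, and iterate $\mu^{l}(v+1)=C^l\mu^{l}(v)$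 for $v=0,\dots,T_c-1$. Then $\theta_i^{k+1}=\theta_i^k+\eta\,\frac{n_{l_i}\mu_i^{l_i}(T_c)}{\delta}\,u_i^k$ for all $i$. Let $\sigma_i\ge 0$ be such that the variance of $W_i$ under the policy with parameter $\theta$ is at most $\sigma_i^2$ for every $\theta$, and put $\sigma_0=\max_i\sigma_i$. **Theorem.** Let $\epsilon>0$, $\delta=\frac{\epsilon}{L\sqrt d}$ and $\eta=\frac{\epsilon^{1.5}}{d^{1.5}\sqrt K}$. Then: (i) $|J^\delta(\theta)-J(\theta)|\le\epsilon$ for every $\theta\in\mathbb R^d$. (ii) $J^\delta$ is differentiable, and if $$K\ge\frac{d^3B^2}{\epsilon^5},\qquad T_e\ge\log_\gamma\frac{\epsilon^{1.5}}{2\sqrt2\,n_0^2LdJ_0},\qquad T_c\ge\log_{\rho_0}\frac{\epsilon^{1.5}}{2\sqrt2\,n_0^2Ld(J_u-J_l+J_0)},$$ where $B=2(NJ_u-J^\delta(\theta^0))+L^4n_0^2\big(\sigma_0^2+(1+\gamma^{T_e})^2J_0^2\big)$, then $$\frac1K\sum_{k=0}^{K-1}\mathbb E\big[\|\nabla J^\delta(\theta^k)\|^2\big]\le\epsilon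 .$$ (If $\rho_0=0$, the condition on $T_c$ is read as $T_c\ge1$; apart from this, the conditions on $T_e$ and $T_c$ are void if $J_0=0$.) -/

import Mathlib

open MeasureTheory ProbabilityTheory
open scoped Matrix

/-- The product of finitely many Markov kernels with a common source: given `a`, the coordinates are
drawn independently, coordinate `i` from `κ i a`. -/
noncomputable def piKernel {ι α : Type*} [Fintype ι] [MeasurableSpace α] {β : ι → Type*}
    [∀ i, MeasurableSpace (β i)] (κ : ∀ i, Kernel α (β i)) [∀ i, IsMarkovKernel (κ i)] :
    Kernel α (∀ i, β i) where
  toFun a := Measure.pi fun i => κ i a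
  measurable' := by
    refine Measurable.measure_of_isPiSystem_of_isProbabilityMeasure
      (S := Set.pi Set.univ '' Set.pi Set.univ fun i => {s : Set (β i) | MeasurableSet s})
      generateFrom_pi.symm isPiSystem_pi ?_
    rintro _ ⟨s, hs, rfl⟩
    simp only [Measure.pi_pi]
    exact Finset.measurable_fun_prod _ fun i _ =>
      Kernel.measurable_coe (κ i) (hs i (Set.mem_univ i))

instance {ι α : Type*} [Fintype ι] [MeasurableSpace α] {β : ι → Type*}
    [∀ i, MeasurableSpace (β i)] (κ : ∀ i, Kernel α (β i)) [∀ i, IsMarkovKernel (κ i)] :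
    IsMarkovKernel (piKernel κ) :=
  ⟨fun a => inferInstanceAs (IsProbabilityMeasure (Measure.pi fun i => κ i a))⟩

/-- The closed in-neighbourhood `{j | (j, i) ∈ E} ∪ {i}` of `i` in the directed graph `E`. -/
def closedIn {N : ℕ} (E : Fin N → Fin N → Prop) (i : Fin N) : Set (Fin N) :=
  {j | E j i ∨ j = i}

/-- The space `ℝ^d`, `d = ∑ i, d i`, of global policy parameters `θ = (θ_1, …, θ_N)`. -/
abbrev Param {N : ℕ} (d : Fin N → ℕ) : Type := EuclideanSpace ℝ (Σ i : Fin N, Fin (d i))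

/-- The block `θ_i ∈ ℝ^{d i}` of the parameter vector `θ`. -/
noncomputable def Param.block {N : ℕ} {d : Fin N → ℕ} (θ : Param d) (i : Fin N) :
    EuclideanSpace ℝ (Fin (d i)) :=
  WithLp.toLp 2 fun k => θ ⟨i, k⟩

theorem Param.measurable_block {N : ℕ} {d : Fin N → ℕ} (i : Fin N) :
    Measurable fun θ : Param d => θ.block i := by
  unfold Param.block
  fun_prop

/-- A networked multi-agent Markov decision process with agents `Fin N`, together with the
parametrized local policies, the initial state distribution and the communication graph. -/
structure NetworkedMDP (N : ℕ) (d : Fin N → ℕ) (S A : Fin N → Type*)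
    [∀ i, MeasurableSpace (S i)] [∀ i, MeasurableSpace (A i)] where
  /-- edges of the state graph -/
  ES : Fin N → Fin N → Prop
  /-- edges of the observation graph -/
  EO : Fin N → Fin N → Prop
  /-- edges of the reward graph -/
  ER : Fin N → Fin N → Prop
  /-- the undirected communication graph -/
  Gcm : SimpleGraph (Fin N)
  /-- local transition probabilities -/
  P : ∀ i, Kernel ((∀ j : closedIn ES i, S j) × (∀ j : closedIn ES i, A j)) (S i)
  markov_P : ∀ i, IsMarkovKernel (P i)
  /-- local rewards -/
  r : ∀ i, (∀ j : closedIn ER i, S j) × (∀ j : closedIn ER i, A j) → ℝ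
  measurable_r : ∀ i, Measurable (r i)
  /-- local policies: the action distribution given the own parameter and the observation -/
  policy : ∀ i, Kernel (EuclideanSpace ℝ (Fin (d i)) × (∀ j : closedIn EO i, S j)) (A i)
  markov_policy : ∀ i, IsMarkovKernel (policy i)
  /-- initial state distribution -/
  D : Measure (∀ i, S i)
  prob_D : IsProbabilityMeasure D
  /-- discount factor -/
  γ : ℝ
  γ_pos : 0 < γ
  γ_lt_one : γ < 1

attribute [instance] NetworkedMDP.markov_P NetworkedMDP.markov_policy NetworkedMDP.prob_D

namespace NetworkedMDP

variable {N : ℕ} {d : Fin N → ℕ} {S A : Fin N → Type*}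
  [∀ i, MeasurableSpace (S i)] [∀ i, MeasurableSpace (A i)]

/-! ### Graphs, local value-function groups and clusters -/

/-- Edges of the union of the state graph and the observation graph. -/
def ESO (M : NetworkedMDP N d S A) (i j : Fin N) : Prop := M.ES i j ∨ M.EO i j

/-- `M.Reach i j`: `j = i`, or there is a path from `i` to `j` along the edges `ESO`. -/
def Reach (M : NetworkedMDP N d S A) (i j : Fin N) : Prop := Relation.ReflTransGen M.ESO i j

/-- The agents whose rewards are summed in the local value function of agent `i`: all `j` whose
closed in-neighbourhood in the reward graph meets the set of agents reachable from `i`. -/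
def IL (M : NetworkedMDP N d S A) (i : Fin N) : Set (Fin N) :=
  {j | (closedIn M.ER j ∩ {k | M.Reach i k}).Nonempty}

/-- Mutual reachability; its classes are the maximal strongly connected components. -/
def sccSetoid (M : NetworkedMDP N d S A) : Setoid (Fin N) where
  r i j := M.Reach i j ∧ M.Reach j i
  iseqv :=
    { refl := fun _ => ⟨Relation.ReflTransGen.refl, Relation.ReflTransGen.refl⟩
      symm := fun h => ⟨h.2, h.1⟩
      trans := fun h h' => ⟨h.1.trans h'.1, h'.2.trans h.2⟩ }

/-- The clusters: the maximal strongly connected components of the graph `ESO`. -/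
def Cluster (M : NetworkedMDP N d S A) : Type := Quotient M.sccSetoid

/-- The cluster `l_i` of agent `i`. -/
def cluster (M : NetworkedMDP N d S A) (i : Fin N) : M.Cluster := Quotient.mk M.sccSetoid i

open Classical in
/-- The agents involved in the local value function of cluster `l` (the sets `IL i`, `i` in the
cluster, coincide). -/
noncomputable def Icl (M : NetworkedMDP N d S A) (l : M.Cluster) : Finset (Fin N) :=
  {j | ∃ i, M.cluster i = l ∧ j ∈ M.IL i}

theorem mem_Icl_cluster (M : NetworkedMDP N d S A) (i j : Fin N) :
    j ∈ M.Icl (M.cluster i) ↔ j ∈ M.IL i := by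
  simp only [Icl, Finset.mem_filter, Finset.mem_univ, true_and]
  refine ⟨?_, fun h => ⟨i, rfl, h⟩⟩
  rintro ⟨i', h, k, hk, hr⟩
  have h' : M.Reach i' i ∧ M.Reach i i' := Quotient.exact h
  exact ⟨k, hk, Relation.ReflTransGen.trans h'.2 hr⟩

/-- `n_l`, the number of agents involved in the local value function of cluster `l`. -/
noncomputable def nl (M : NetworkedMDP N d S A) (l : M.Cluster) : ℕ := (M.Icl l).card

/-- `n_0 = max_l n_l`. -/
noncomputable def n0 (M : NetworkedMDP N d S A) : ℕ := ⨆ l, M.nl l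

/-! ### Communication weights -/

/-- The principal submatrix of `C l` on the agents involved in the value function of cluster `l`. -/
def C0 (M : NetworkedMDP N d S A) (C : M.Cluster → Matrix (Fin N) (Fin N) ℝ) (l : M.Cluster) :
    Matrix (M.Icl l) (M.Icl l) ℝ :=
  (C l).submatrix Subtype.val Subtype.val

/-- Consensus weights: inside the group `Icl l` the weight of every communication link and every
self-weight is positive, all other off-diagonal weights vanish, and the weights restricted to the
group are doubly stochastic. -/
structure IsConsensusWeights (M : NetworkedMDP N d S A)
    (C : M.Cluster → Matrix (Fin N) (Fin N) ℝ) : Prop where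
  pos : ∀ l i j, i ∈ M.Icl l → j ∈ M.Icl l → (i = j ∨ M.Gcm.Adj i j) → 0 < C l i j
  zero : ∀ l i j, i ≠ j → ¬ (i ∈ M.Icl l ∧ j ∈ M.Icl l ∧ M.Gcm.Adj i j) → C l i j = 0
  doublyStochastic : ∀ l, M.C0 C l ∈ doublyStochastic ℝ (M.Icl l)

/-- `ρ_l = ‖C_0^l - (1/n_l) 1 1ᵀ‖`, in the spectral norm. -/
noncomputable def rhoL (M : NetworkedMDP N d S A) (C : M.Cluster → Matrix (Fin N) (Fin N) ℝ)
    (l : M.Cluster) : ℝ :=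
  ‖Matrix.toEuclideanCLM (n := M.Icl l) (𝕜 := ℝ)
    (M.C0 C l - (1 / (M.nl l : ℝ)) • Matrix.of fun _ _ => (1 : ℝ))‖

/-- `ρ_0 = max_l ρ_l`. -/
noncomputable def rho0 (M : NetworkedMDP N d S A) (C : M.Cluster → Matrix (Fin N) (Fin N) ℝ) : ℝ :=
  ⨆ l, M.rhoL C l

/-! ### The controlled process and the value functions -/

/-- The joint action distribution under the global policy with parameter `θ` in state `s`. -/
noncomputable def actionKernel (M : NetworkedMDP N d S A) :
    Kernel (Param d × (∀ i, S i)) (∀ i, A i) :=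
  piKernel fun i =>
    (M.policy i).comap (fun x => (x.1.block i, fun j => x.2 j))
      (((Param.measurable_block i).comp measurable_fst).prodMk (by fun_prop))

instance (M : NetworkedMDP N d S A) : IsMarkovKernel M.actionKernel := by
  unfold actionKernel; infer_instance

/-- The joint transition probability. -/
noncomputable def transKernel (M : NetworkedMDP N d S A) :
    Kernel ((∀ i, S i) × (∀ i, A i)) (∀ i, S i) :=
  piKernel fun i => (M.P i).comap (fun x => (fun j => x.1 j, fun j => x.2 j)) (by fun_prop)

instance (M : NetworkedMDP N d S A) : IsMarkovKernel M.transKernel := by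
  unfold transKernel; infer_instance

/-- Given a parameter and a state, draw the action; the parameter and the state are kept. -/
noncomputable def actKernel (M : NetworkedMDP N d S A) :
    Kernel (Param d × (∀ i, S i)) ((Param d × (∀ i, S i)) × (∀ i, A i)) :=
  Kernel.id ×ₖ M.actionKernel

instance (M : NetworkedMDP N d S A) : IsMarkovKernel M.actKernel := by
  unfold actKernel; infer_instance

/-- One time step: draw the next state, then the next action; the parameter is kept. -/
noncomputable def timeStep (M : NetworkedMDP N d S A) :
    Kernel ((Param d × (∀ i, S i)) × (∀ i, A i)) ((Param d × (∀ i, S i)) × (∀ i, A i)) :=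
  M.actKernel ∘ₖ
    (Kernel.deterministic (fun x => x.1.1) (by fun_prop) ×ₖ
      M.transKernel.comap (fun x => (x.1.2, x.2)) (by fun_prop))

instance (M : NetworkedMDP N d S A) : IsMarkovKernel M.timeStep := by
  unfold timeStep; infer_instance

/-- The law of the infinite trajectory `(s(t), a(t))`, `t = 0, 1, …`, of the process controlled by
the policy with parameter `θ` and started in the state `s`, as a kernel in `(θ, s)`. -/
noncomputable def trajKernel (M : NetworkedMDP N d S A) :
    Kernel (Param d × (∀ i, S i)) (ℕ → (∀ i, S i) × (∀ i, A i)) :=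
  ((Kernel.traj (X := fun _ => (Param d × (∀ i, S i)) × (∀ i, A i))
      (fun n => M.timeStep.comap
        (fun h => h ⟨n, Finset.mem_Iic.2 le_rfl⟩) (measurable_pi_apply _)) 0) ∘ₖ
    (M.actKernel.map fun x (_ : Finset.Iic 0) => x)).map
  fun ω t => ((ω t).1.2, (ω t).2)

/-- The law of the trajectory with initial state drawn from `D`, as a kernel in `θ`. -/
noncomputable def epKernel (M : NetworkedMDP N d S A) :
    Kernel (Param d) (ℕ → (∀ i, S i) × (∀ i, A i)) :=
  M.trajKernel ∘ₖ (Kernel.id ×ₖ Kernel.const (Param d) M.D)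

/-- The reward of agent `i` at joint state and action `x`. -/
def reward (M : NetworkedMDP N d S A) (i : Fin N) (x : (∀ i, S i) × (∀ i, A i)) : ℝ :=
  M.r i (fun j => x.1 j, fun j => x.2 j)

/-- The local state value function `V_i^{π(θ)}(s)` for the individual reward of agent `i`. -/
noncomputable def V (M : NetworkedMDP N d S A) (i : Fin N) (θ : Param d) (s : ∀ i, S i) : ℝ :=
  ∫ ω, ∑' t : ℕ, M.γ ^ t * M.reward i (ω t) ∂(M.trajKernel (θ, s))

/-- The global state value function `V^{π(θ)}(s)`. -/
noncomputable def globalV (M : NetworkedMDP N d S A) (θ : Param d) (s : ∀ i, S i) : ℝ :=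
  ∫ ω, ∑' t : ℕ, M.γ ^ t * ∑ i, M.reward i (ω t) ∂(M.trajKernel (θ, s))

/-- The global objective `J(θ) = E_{s ∼ D} V^{π(θ)}(s)`. -/
noncomputable def J (M : NetworkedMDP N d S A) (θ : Param d) : ℝ :=
  ∫ s, M.globalV θ s ∂M.D

/-- The Gaussian smoothing `J^δ(θ) = E J(θ + δ u)`, `u ∼ N(0, I_d)`. -/
noncomputable def Jsmooth (M : NetworkedMDP N d S A) (δ : ℝ) (θ : Param d) : ℝ :=
  ∫ u, M.J (θ + δ • u) ∂(stdGaussian (Param d))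

/-- The observed value `W_i = ∑_{t < T_e} γ^t r_i(t)` of agent `i` along a trajectory. -/
noncomputable def W (M : NetworkedMDP N d S A) (Te : ℕ) (i : Fin N)
    (ω : ℕ → (∀ i, S i) × (∀ i, A i)) : ℝ :=
  ∑ t ∈ Finset.range Te, M.γ ^ t * M.reward i (ω t)

/-! ### The distributed algorithm -/

/-- The estimates `μ^l(T_c)` after `T_c` consensus steps `μ_i ← ∑_j C^l_{ij} μ_j`, started from
`μ_i^l(0) = W_i` for the agents in `Icl l` and `0` for the others. For consensus weights only
agents `j` equal to `i` or adjacent to `i` contribute to the sum. -/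
noncomputable def consensus (M : NetworkedMDP N d S A)
    (C : M.Cluster → Matrix (Fin N) (Fin N) ℝ) (Te Tc : ℕ) (l : M.Cluster)
    (ω : ℕ → (∀ i, S i) × (∀ i, A i)) : Fin N → ℝ :=
  (fun μ => C l *ᵥ μ)^[Tc] fun i => if i ∈ M.Icl l then M.W Te i ω else 0

/-- The zeroth-order oracle with blocks `g_i = (n_{l_i} μ_i^{l_i}(T_c) / δ) u_i`. -/
noncomputable def oracle (M : NetworkedMDP N d S A)
    (C : M.Cluster → Matrix (Fin N) (Fin N) ℝ) (δ : ℝ) (Te Tc : ℕ) (u : Param d)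
    (ω : ℕ → (∀ i, S i) × (∀ i, A i)) : Param d :=
  WithLp.toLp 2 fun p =>
    (M.nl (M.cluster p.1) * M.consensus C Te Tc (M.cluster p.1) ω p.1 / δ) * u p

/-- The randomness of one learning epoch at current parameter `θ`: the perturbation
`u ∼ N(0, I_d)`, and the trajectory under the policy with parameter `θ + δ u`. -/
noncomputable def epochKernel (M : NetworkedMDP N d S A) (δ : ℝ) :
    Kernel (Param d) (Param d × (ℕ → (∀ i, S i) × (∀ i, A i))) :=
  Kernel.const (Param d) (stdGaussian (Param d)) ⊗ₖ
    M.epKernel.comap (fun x => x.1 + δ • x.2) (by fun_prop)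

/-- The law of the `k`-th iterate `θ^k`, where `θ^{k+1} = θ^k + η g(θ^k, u^k, ξ^k)`. -/
noncomputable def iterLaw (M : NetworkedMDP N d S A)
    (C : M.Cluster → Matrix (Fin N) (Fin N) ℝ) (δ η : ℝ) (Te Tc : ℕ) (θ₀ : Param d) :
    ℕ → Measure (Param d)
  | 0 => Measure.dirac θ₀
  | k + 1 => (M.iterLaw C δ η Te Tc θ₀ k ⊗ₘ M.epochKernel δ).map
      fun x => x.1 + η • M.oracle C δ Te Tc x.2.1 x.2.2

end NetworkedMDP

/-! The algorithm is stochastic gradient ascent on `Jsmooth δ`, driven by an oracle with small bias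
and bounded second moment.

Smoothing. The Cameron–Martin formula moves a shift of θ into an exponential density, so the
gradient of the smoothing is E[J(θ + δu) u / δ] and J itself is never differentiated
(`hasFDerivAt_gaussian_smoothing`). Since J is L-Lipschitz and E‖u‖ ≤ √d, the smoothing error is at
most Lδ√d = ε, and the gradient is Lipschitz with constant Λ = L√d/δ.

Locality. If j lies outside `IL i`, its reward only involves agents that are not reachable from i.
These agents are influenced only by one another, so their law ignores θ_i (`integral_timeLaw_congr`,
`V_congr`). Hence block i of the gradient does not change when J is replaced by the sum over the
group of i (`gradient_Jsmooth_apply`).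

Oracle. It replaces that group sum by n_l times a consensus estimate. The error consists of a
truncation part of order γ^Te and a mixing part of order ρ₀^Tc, where ρ₀ < 1 by connectedness and
positive self-weights (`norm_sub_avg_lt_one`). The bias is therefore at most √ε/2. Averaging with
stochastic rows does not increase second moments, so E‖g‖² ≤ Q = n₀²(σ₀² + J₀²)d/δ².

Ascent. The descent lemma bounds the expected gain of one epoch below by η(¾‖∇‖² − ε/4) − Λη²Q/2.
Summed over K epochs and compared with the upper bound N·Ju, the quadratic terms total L⁴n₀²(σ₀² +
J₀²)/2 whatever K is. The condition on K makes all constant contributions at most Kηε/2; together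
with Kηε/4 this matches the factor ¾. -/

section StdGaussian

/-! ### Gaussian measure: Cameron–Martin shift, moments, and differentiation of smoothings. -/

variable {ι : Type*} [Fintype ι]

/-- Independence of the coordinates factors the integral into one-dimensional moment generating
functions. Complex coefficients are needed because a real exponential tilt is combined with a
characteristic function below. -/
theorem integral_cexp_stdGaussian (a : ι → ℂ) :
    ∫ u, Complex.exp (∑ i, a i * u i) ∂(stdGaussian (EuclideanSpace ℝ ι))
      = Complex.exp (∑ i, a i ^ 2 / 2) := by
  rw [← map_pi_eq_stdGaussian, integral_map (by fun_prop) (by fun_prop)]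
  simp_rw [Complex.exp_sum]
  rw [integral_fintype_prod_eq_prod (f := fun i (x : ℝ) => Complex.exp (a i * x))]
  refine Finset.prod_congr rfl fun i _ => ?_
  have := complexMGF_id_gaussianReal (μ := 0) (v := 1) (a i)
  simp only [complexMGF, id] at this
  rw [this]
  simp

/-- Fernique's theorem makes exp(C‖u‖²) integrable for some C > 0, and completing the square absorbs
the linear exponent into it. -/
theorem integrable_exp_norm_stdGaussian (R : ℝ) :
    Integrable (fun u => Real.exp (R * ‖u‖)) (stdGaussian (EuclideanSpace ℝ ι)) := by
  obtain ⟨C, hC, hi⟩ := IsGaussian.exists_integrable_exp_sq (stdGaussian (EuclideanSpace ℝ ι))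
  refine (hi.const_mul (Real.exp (R ^ 2 / (4 * C)))).mono' (by fun_prop) (ae_of_all _ fun u => ?_)
  rw [Real.norm_of_nonneg (Real.exp_nonneg _), ← Real.exp_add]
  refine Real.exp_le_exp.2 ?_
  have h : R ^ 2 / (4 * C) + C * ‖u‖ ^ 2 - R * ‖u‖ = (R - 2 * C * ‖u‖) ^ 2 / (4 * C) := by
    field_simp; ring
  have : 0 ≤ (R - 2 * C * ‖u‖) ^ 2 / (4 * C) := by positivity
  linarith

theorem integrable_exp_inner_stdGaussian (h : EuclideanSpace ℝ ι) :
    Integrable (fun u => Real.exp (inner ℝ h u - ‖h‖ ^ 2 / 2))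
      (stdGaussian (EuclideanSpace ℝ ι)) := by
  refine (integrable_exp_norm_stdGaussian ‖h‖).mono' (by fun_prop) (ae_of_all _ fun u => ?_)
  rw [Real.norm_of_nonneg (Real.exp_nonneg _)]
  refine Real.exp_le_exp.2 ?_
  have := real_inner_le_norm h u
  have : 0 ≤ ‖h‖ ^ 2 / 2 := by positivity
  linarith

/-- The Cameron–Martin formula for the standard Gaussian measure. -/
theorem map_add_stdGaussian (h : EuclideanSpace ℝ ι) :
    (stdGaussian (EuclideanSpace ℝ ι)).map (fun u => u + h) =
      (stdGaussian (EuclideanSpace ℝ ι)).withDensity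
        fun u => ENNReal.ofReal (Real.exp (inner ℝ h u - ‖h‖ ^ 2 / 2)) := by
  have := isFiniteMeasure_withDensity_ofReal (integrable_exp_inner_stdGaussian h).2
  have : IsFiniteMeasure ((stdGaussian (EuclideanSpace ℝ ι)).map (fun u => u + h)) := by
    infer_instance
  -- Both measures are finite, hence determined by their characteristic functions; that of the
  -- tilted measure is a Gaussian integral with complex exponent h + it.
  refine Measure.ext_of_charFun (funext fun t => ?_)
  rw [charFun_map_add_const, charFun_stdGaussian, charFun_apply,
    integral_withDensity_eq_integral_toReal_smul (by fun_prop) (by simp)]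
  simp_rw [ENNReal.toReal_ofReal (Real.exp_nonneg _)]
  have key : ∀ u : EuclideanSpace ℝ ι,
      Real.exp (inner ℝ h u - ‖h‖ ^ 2 / 2) • Complex.exp (inner ℝ u t * Complex.I)
      = Complex.exp (-‖h‖ ^ 2 / 2) * Complex.exp (∑ i, (h i + t i * Complex.I) * u i) := by
    intro u
    rw [Complex.real_smul, Complex.ofReal_exp, ← Complex.exp_add, ← Complex.exp_add]
    congr 1
    simp only [PiLp.inner_apply, RCLike.inner_apply, conj_trivial]
    push_cast
    simp only [add_mul, Finset.sum_add_distrib, Finset.sum_mul]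
    rw [show ∀ a b c d e : ℂ, a = d → c = e → a - b / 2 + c = -b / 2 + (d + e) from
      fun a b c d e h1 h2 => by rw [h1, h2]; ring]
    · exact Finset.sum_congr rfl fun i _ => by ring
    · exact Finset.sum_congr rfl fun i _ => by ring
  simp_rw [key]
  rw [integral_const_mul, integral_cexp_stdGaussian, ← Complex.exp_add, ← Complex.exp_add]
  congr 1
  rw [← Complex.ofReal_pow, ← Complex.ofReal_pow, EuclideanSpace.real_norm_sq_eq,
    EuclideanSpace.real_norm_sq_eq]
  simp only [PiLp.inner_apply, RCLike.inner_apply, conj_trivial]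
  push_cast
  rw [← Finset.sum_neg_distrib, ← Finset.sum_neg_distrib, Finset.sum_div, Finset.sum_div,
    Finset.sum_mul, ← Finset.sum_add_distrib, ← Finset.sum_add_distrib]
  refine Finset.sum_congr rfl fun i _ => ?_
  ring_nf
  rw [Complex.I_sq]
  ring

/-- The dependence on h passes from the argument of f to a smooth factor, so no regularity of f
beyond measurability is needed to differentiate in h. -/
theorem integral_add_stdGaussian (h : EuclideanSpace ℝ ι) {f : EuclideanSpace ℝ ι → ℝ}
    (hf : Measurable f) :
    ∫ u, f (u + h) ∂(stdGaussian (EuclideanSpace ℝ ι)) =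
      ∫ u, Real.exp (inner ℝ h u - ‖h‖ ^ 2 / 2) * f u ∂(stdGaussian (EuclideanSpace ℝ ι)) := by
  rw [← integral_map (φ := fun u => u + h) (by fun_prop) hf.aestronglyMeasurable,
    map_add_stdGaussian, integral_withDensity_eq_integral_toReal_smul (by fun_prop) (by simp)]
  simp_rw [ENNReal.toReal_ofReal (Real.exp_nonneg _), smul_eq_mul]

theorem integrable_norm_stdGaussian :
    Integrable (fun u => ‖u‖) (stdGaussian (EuclideanSpace ℝ ι)) :=
  IsGaussian.integrable_id.norm

theorem integrable_norm_sq_stdGaussian :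
    Integrable (fun u => ‖u‖ ^ 2) (stdGaussian (EuclideanSpace ℝ ι)) :=
  (IsGaussian.memLp_two_id (μ := stdGaussian (EuclideanSpace ℝ ι))).integrable_norm_pow (by simp)

theorem integral_norm_sq_stdGaussian :
    ∫ u, ‖u‖ ^ 2 ∂(stdGaussian (EuclideanSpace ℝ ι)) = Fintype.card ι := by
  classical
  have h1 : ∀ i : ι, MemLp (fun u : EuclideanSpace ℝ ι => u i) 2
      (stdGaussian (EuclideanSpace ℝ ι)) := fun i =>
    (IsGaussian.memLp_two_id (μ := stdGaussian (EuclideanSpace ℝ ι))).mono (by fun_prop)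
      (ae_of_all _ fun u => PiLp.norm_apply_le u i)
  simp_rw [EuclideanSpace.real_norm_sq_eq]
  rw [integral_finsetSum _ fun i _ => (h1 i).integrable_sq]
  rw [Finset.sum_congr rfl fun i _ => ?_, Finset.sum_const, Finset.card_univ, nsmul_eq_mul, mul_one]
  have h2 := variance_dual_stdGaussian (innerSL ℝ (EuclideanSpace.single i (1 : ℝ)))
  have h3 := integral_strongDual_stdGaussian (innerSL ℝ (EuclideanSpace.single i (1 : ℝ)))
  have h4 : (⇑(innerSL ℝ (EuclideanSpace.single i (1 : ℝ))) : EuclideanSpace ℝ ι → ℝ) =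
      fun u => u i := by
    ext u; simp [EuclideanSpace.inner_single_left]
  rw [h4] at h2 h3
  rw [variance_of_integral_eq_zero (by fun_prop) h3] at h2
  rw [h2]
  simp

/-- Nonnegativity of the variance of ‖u‖ gives (E‖u‖)² ≤ E‖u‖² = d. -/
theorem integral_norm_stdGaussian_le :
    ∫ u, ‖u‖ ∂(stdGaussian (EuclideanSpace ℝ ι)) ≤ √(Fintype.card ι) := by
  rw [← integral_norm_sq_stdGaussian]
  refine Real.le_sqrt_of_sq_le ?_
  have h := variance_nonneg (fun u => ‖u‖) (stdGaussian (EuclideanSpace ℝ ι))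
  rw [variance_eq_sub] at h
  · simpa using h
  · exact (IsGaussian.memLp_two_id (μ := stdGaussian (EuclideanSpace ℝ ι))).norm

/-- The gradient of a Gaussian smoothing of a bounded function. -/
theorem hasFDerivAt_gaussian_smoothing {f : EuclideanSpace ℝ ι → ℝ} (hf : Measurable f) {c : ℝ}
    (hc : ∀ x, |f x| ≤ c) {δ : ℝ} (hδ : 0 < δ) (θ : EuclideanSpace ℝ ι) :
    HasFDerivAt (fun θ => ∫ u, f (θ + δ • u) ∂(stdGaussian (EuclideanSpace ℝ ι)))
      (∫ u, (f (θ + δ • u) / δ) • innerSL ℝ u ∂(stdGaussian (EuclideanSpace ℝ ι))) θ := by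
  have hc0 : 0 ≤ c := (abs_nonneg _).trans (hc 0)
  -- Φ h is the smoothing at θ + δh after the shift has been moved into the density; f enters only
  -- as a bounded factor independent of h.
  let Φ : EuclideanSpace ℝ ι → ℝ := fun h =>
    ∫ u, Real.exp (inner ℝ h u - ‖h‖ ^ 2 / 2) * f (θ + δ • u)
      ∂(stdGaussian (EuclideanSpace ℝ ι))
  have hΦ : HasFDerivAt Φ (∫ u, f (θ + δ • u) • innerSL ℝ u
      ∂(stdGaussian (EuclideanSpace ℝ ι))) 0 := by
    have hder : ∀ h u : EuclideanSpace ℝ ι, HasFDerivAt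
        (fun h => Real.exp (inner ℝ h u - ‖h‖ ^ 2 / 2) * f (θ + δ • u))
        ((f (θ + δ • u) * Real.exp (inner ℝ h u - ‖h‖ ^ 2 / 2)) •
          (innerSL ℝ u - innerSL ℝ h)) h := by
      intro h u
      have h1 : HasFDerivAt (fun h : EuclideanSpace ℝ ι => inner ℝ h u) (innerSL ℝ u) h := by
        have := (innerSL ℝ u).hasFDerivAt (x := h)
        refine this.congr_of_eventuallyEq (Filter.Eventually.of_forall fun x => ?_)
        simp [real_inner_comm]
      have h2 : HasFDerivAt (fun h : EuclideanSpace ℝ ι => ‖h‖ ^ 2 / 2) (innerSL ℝ h) h := by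
        have := (hasStrictFDerivAt_norm_sq h).hasFDerivAt.mul_const (2 : ℝ)⁻¹
        refine this.congr_fderiv ?_
        ext v
        simp
      refine (((h1.sub h2).exp).mul_const (f (θ + δ • u))).congr_fderiv ?_
      rw [smul_smul]
      rfl
    have := hasFDerivAt_integral_of_dominated_of_fderiv_le
      (μ := stdGaussian (EuclideanSpace ℝ ι)) (𝕜 := ℝ)
      (F := fun h u => Real.exp (inner ℝ h u - ‖h‖ ^ 2 / 2) * f (θ + δ • u))
      (F' := fun h u => (f (θ + δ • u) * Real.exp (inner ℝ h u - ‖h‖ ^ 2 / 2)) •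
          (innerSL ℝ u - innerSL ℝ h))
      (x₀ := (0 : EuclideanSpace ℝ ι)) (s := Metric.ball 0 1)
      -- For ‖h‖ < 1 the density is at most exp ‖u‖, and ‖u - h‖ ≤ ‖u‖ + 1 ≤ exp ‖u‖ bounds the
      -- derivative of its exponent.
      (bound := fun u => c * Real.exp (2 * ‖u‖))
      (Metric.ball_mem_nhds _ one_pos) ?_ ?_ ?_ ?_ ?_ ?_
    · simpa using this
    · exact Filter.Eventually.of_forall fun h => by
        have : Measurable fun u : EuclideanSpace ℝ ι => f (θ + δ • u) := hf.comp (by fun_prop)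
        fun_prop
    · refine Integrable.of_bound (C := c) ?_ (ae_of_all _ fun u => ?_)
      · have : Measurable fun u : EuclideanSpace ℝ ι => f (θ + δ • u) := hf.comp (by fun_prop)
        fun_prop
      · simpa using hc _
    · have : Measurable fun u : EuclideanSpace ℝ ι => f (θ + δ • u) := hf.comp (by fun_prop)
      have hm : Measurable fun u : EuclideanSpace ℝ ι =>
          f (θ + δ • u) * Real.exp (inner ℝ 0 u - ‖(0 : EuclideanSpace ℝ ι)‖ ^ 2 / 2) := by
        fun_prop
      refine hm.aestronglyMeasurable.smul ?_
      exact (Continuous.sub (innerSL ℝ).continuous continuous_const).aestronglyMeasurable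
    · refine ae_of_all _ fun u h hh => ?_
      have hh1 : ‖h‖ ≤ 1 := by simpa using (Metric.mem_ball.1 hh).le
      rw [norm_smul, ← map_sub, innerSL_apply_norm, norm_mul, Real.norm_of_nonneg (Real.exp_nonneg _),
        mul_assoc]
      refine mul_le_mul (hc _) ?_ (by positivity) hc0
      have h1 : ‖u - h‖ ≤ ‖u‖ + 1 := (norm_sub_le _ _).trans (by linarith)
      have h2 : ‖u‖ + 1 ≤ Real.exp ‖u‖ := Real.add_one_le_exp _
      have h3 : Real.exp (inner ℝ h u - ‖h‖ ^ 2 / 2) ≤ Real.exp ‖u‖ := by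
        refine Real.exp_le_exp.2 ?_
        have := real_inner_le_norm h u
        nlinarith [norm_nonneg u, sq_nonneg ‖h‖]
      calc _ ≤ Real.exp ‖u‖ * Real.exp ‖u‖ := by gcongr; exact h1.trans h2
        _ = _ := by rw [← Real.exp_add]; ring_nf
    · exact (integrable_exp_norm_stdGaussian 2).const_mul c
    · exact ae_of_all _ fun u h _ => hder h u
  have hcomp : HasFDerivAt (fun θ' : EuclideanSpace ℝ ι => δ⁻¹ • (θ' - θ))
      (δ⁻¹ • ContinuousLinearMap.id ℝ (EuclideanSpace ℝ ι)) θ :=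
    ((hasFDerivAt_id θ).sub_const θ).const_smul δ⁻¹
  have h0 : HasFDerivAt Φ (∫ u, f (θ + δ • u) • innerSL ℝ u
      ∂(stdGaussian (EuclideanSpace ℝ ι))) (δ⁻¹ • (θ - θ)) := by simpa using hΦ
  have hfin := h0.comp θ hcomp
  -- Here θ' + δu = θ + δ(u + h) with h = (θ' - θ)/δ, so the shift formula applies to u ↦ f(θ + δu).
  have heq : (fun θ' => ∫ u, f (θ' + δ • u) ∂(stdGaussian (EuclideanSpace ℝ ι))) =
      Φ ∘ fun θ' => δ⁻¹ • (θ' - θ) := by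
    ext θ'
    have := integral_add_stdGaussian (δ⁻¹ • (θ' - θ)) (f := fun u => f (θ + δ • u))
      (hf.comp (by fun_prop))
    simp only [Function.comp_apply, Φ]
    rw [← this]
    refine integral_congr_ae (ae_of_all _ fun u => ?_)
    simp only
    congr 1
    rw [smul_add, smul_inv_smul₀ hδ.ne']
    abel
  rw [heq]
  refine hfin.congr_fderiv ?_
  ext v
  simp only [ContinuousLinearMap.comp_apply, smul_apply,
    ContinuousLinearMap.id_apply, map_smul]
  rw [← smul_apply, ← integral_smul]
  congr 1
  refine integral_congr_ae (ae_of_all _ fun u => ?_)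
  simp only [smul_smul, div_eq_inv_mul]

theorem integrable_smul_id_stdGaussian {f : EuclideanSpace ℝ ι → ℝ} (hf : Measurable f) {c : ℝ}
    (hc : ∀ x, |f x| ≤ c) :
    Integrable (fun u => f u • u) (stdGaussian (EuclideanSpace ℝ ι)) := by
  refine (integrable_norm_stdGaussian.const_mul c).mono' ?_ (ae_of_all _ fun u => ?_)
  · exact (hf.smul measurable_id).aestronglyMeasurable
  · rw [norm_smul]
    gcongr
    exact hc u

theorem hasGradientAt_gaussian_smoothing {f : EuclideanSpace ℝ ι → ℝ} (hf : Measurable f) {c : ℝ}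
    (hc : ∀ x, |f x| ≤ c) {δ : ℝ} (hδ : 0 < δ) (θ : EuclideanSpace ℝ ι) :
    HasGradientAt (fun θ => ∫ u, f (θ + δ • u) ∂(stdGaussian (EuclideanSpace ℝ ι)))
      (∫ u, (f (θ + δ • u) / δ) • u ∂(stdGaussian (EuclideanSpace ℝ ι))) θ := by
  rw [hasGradientAt_iff_hasFDerivAt]
  refine (hasFDerivAt_gaussian_smoothing hf hc hδ θ).congr_fderiv ?_
  have hint : Integrable (fun u => (f (θ + δ • u) / δ) • u)
      (stdGaussian (EuclideanSpace ℝ ι)) :=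
    integrable_smul_id_stdGaussian (f := fun u => f (θ + δ • u) / δ) (c := c / δ)
      ((hf.comp (by fun_prop)).div_const δ) fun x => by
        rw [abs_div, abs_of_pos hδ]; gcongr; exact hc _
  have := (innerSL ℝ (E := EuclideanSpace ℝ ι)).integral_comp_comm hint
  simp only [map_smul] at this
  rw [this]
  rfl

end StdGaussian

/-! ### Integrals against kernels, product measures, and time marginals of Markov chains. -/

section KernelFacts

theorem abs_integral_le_of_abs_le {Ω : Type*} [MeasurableSpace Ω] {μ : Measure Ω}
    [IsProbabilityMeasure μ] {f : Ω → ℝ} {c : ℝ} (hc : ∀ x, |f x| ≤ c) :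
    |∫ x, f x ∂μ| ≤ c := by
  simpa using norm_integral_le_of_norm_le_const (μ := μ) (f := f) (ae_of_all _ hc)

theorem integrable_of_abs_le {Ω : Type*} [MeasurableSpace Ω] {μ : Measure Ω}
    [IsFiniteMeasure μ] {f : Ω → ℝ} (hf : Measurable f) {c : ℝ} (hc : ∀ x, |f x| ≤ c) :
    Integrable f μ :=
  Integrable.of_bound hf.aestronglyMeasurable c (ae_of_all _ hc)

theorem measurable_integral_kernel {α β : Type*} [MeasurableSpace α] [MeasurableSpace β]
    (κ : Kernel α β) [IsSFiniteKernel κ] {f : β → ℝ} (hf : Measurable f) :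
    Measurable fun a => ∫ b, f b ∂(κ a) :=
  (StronglyMeasurable.integral_kernel (κ := κ) hf.stronglyMeasurable).measurable

/-- The integral of a function of finitely many coordinates against a product measure depends only
on the corresponding factors. -/
theorem integral_pi_congr_of_dependsOn {ι : Type*} [Fintype ι] {X : ι → Type*}
    [∀ i, MeasurableSpace (X i)] (μ ν : ∀ i, Measure (X i)) [∀ i, IsProbabilityMeasure (μ i)]
    [∀ i, IsProbabilityMeasure (ν i)] (T : Set ι) (h : ∀ i ∈ T, μ i = ν i) {f : (∀ i, X i) → ℝ}
    (hf : Measurable f) (hT : ∀ x y : ∀ i, X i, (∀ i ∈ T, x i = y i) → f x = f y) :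
    ∫ x, f x ∂(Measure.pi μ) = ∫ x, f x ∂(Measure.pi ν) := by
  classical
  have hne : ∀ i, Nonempty (X i) := fun i => nonempty_of_isProbabilityMeasure (μ i)
  let z : ∀ i, X i := fun i => (hne i).some
  -- Freezing the coordinates outside T leaves f unchanged, while both families of factors, pushed
  -- forward by g, become equal: the same measures on T and Dirac masses elsewhere.
  let g : ∀ i, X i → X i := fun i x => if i ∈ T then x else z i
  have hg : ∀ i, Measurable (g i) := fun i => by
    by_cases hi : i ∈ T
    · simp only [g, hi, if_true]; exact measurable_id
    · simp only [g, hi, if_false]; exact measurable_const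
  have hG : Measurable fun (x : ∀ i, X i) i => g i (x i) :=
    measurable_pi_lambda _ fun i => (hg i).comp (measurable_pi_apply i)
  have hfg : ∀ x : ∀ i, X i, f x = f fun i => g i (x i) := fun x =>
    hT _ _ fun i hi => by simp [g, hi]
  have key : ∀ (κ : ∀ i, Measure (X i)) [∀ i, IsProbabilityMeasure (κ i)],
      ∫ x, f x ∂(Measure.pi κ) = ∫ x, f x ∂(Measure.pi fun i => (κ i).map (g i)) := by
    intro κ _
    have : ∀ i, IsProbabilityMeasure ((κ i).map (g i)) := fun i =>
      Measure.isProbabilityMeasure_map (hg i).aemeasurable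
    rw [← Measure.pi_map_pi (μ := κ) (f := g) fun i => (hg i).aemeasurable,
      integral_map hG.aemeasurable hf.aestronglyMeasurable]
    exact integral_congr_ae (ae_of_all _ hfg)
  rw [key μ, key ν]
  congr 2
  funext i
  by_cases hi : i ∈ T
  · rw [h i hi]
  · have : g i = fun _ => z i := by funext x; simp [g, hi]
    rw [this, Measure.map_const, Measure.map_const]
    simp

open Kernel in
/-- The time marginals of a homogeneous Markov chain. -/
theorem traj_map_eval_succ {X : Type*} [MeasurableSpace X] (κ : Kernel X X) [IsMarkovKernel κ]
    (n : ℕ) :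
    (traj (X := fun _ => X) (fun n => κ.comap (fun h : Finset.Iic n → X =>
        h ⟨n, Finset.mem_Iic.2 le_rfl⟩) (measurable_pi_apply _)) 0).map (fun ω => ω (n + 1)) =
      κ ∘ₖ (traj (X := fun _ => X) (fun n => κ.comap (fun h : Finset.Iic n → X =>
        h ⟨n, Finset.mem_Iic.2 le_rfl⟩) (measurable_pi_apply _)) 0).map (fun ω => ω n) := by
  -- Evaluation at time m factors through the path up to time m, whose law is a partial trajectory
  -- obeying a one-step recursion.
  have hev : ∀ m : ℕ, (fun ω : ℕ → X => ω m) =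
      (fun x : Finset.Iic m → X => x ⟨m, Finset.mem_Iic.2 le_rfl⟩) ∘
        Preorder.frestrictLe (π := fun _ => X) m := fun m => rfl
  rw [hev (n + 1), hev n,
    map_comp_right _ (Preorder.measurable_frestrictLe (X := fun _ => X) _) (by fun_prop),
    map_comp_right _ (Preorder.measurable_frestrictLe (X := fun _ => X) _) (by fun_prop), traj_map_frestrictLe, traj_map_frestrictLe,
    partialTraj_succ_eq_comp (Nat.zero_le n), map_comp, map_partialTraj_succ_self,
    ← deterministic_comp_eq_map (measurable_pi_apply _), ← comp_assoc, comp_deterministic_eq_comap]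

open Kernel in
theorem traj_map_eval_zero {X : Type*} [MeasurableSpace X]
    (κ : (n : ℕ) → Kernel (Finset.Iic n → X) X) [∀ n, IsMarkovKernel (κ n)] :
    (traj (X := fun _ => X) κ 0).map (fun ω => ω 0) =
      deterministic (fun x : Finset.Iic 0 → X => x ⟨0, Finset.mem_Iic.2 le_rfl⟩)
        (measurable_pi_apply _) := by
  have hev : (fun ω : ℕ → X => ω 0) =
      (fun x : Finset.Iic 0 → X => x ⟨0, Finset.mem_Iic.2 le_rfl⟩) ∘
        Preorder.frestrictLe (π := fun _ => X) 0 := rfl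
  rw [hev, map_comp_right _ (Preorder.measurable_frestrictLe (X := fun _ => X) _) (by fun_prop),
    traj_map_frestrictLe, partialTraj_self,
    Kernel.id, deterministic_map]
  · rfl
  · fun_prop

end KernelFacts

/-! ### Locality: an agent's parameter affects only the value functions in its own group. -/

namespace NetworkedMDP

variable {N : ℕ} {d : Fin N → ℕ} {S A : Fin N → Type*}
  [∀ i, MeasurableSpace (S i)] [∀ i, MeasurableSpace (A i)]

/-- The law at time `t` of parameter, state and action. -/
noncomputable def timeLaw (M : NetworkedMDP N d S A) :
    ℕ → Kernel (Param d × (∀ i, S i)) ((Param d × (∀ i, S i)) × (∀ i, A i))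
  | 0 => M.actKernel
  | t + 1 => M.timeStep ∘ₖ M.timeLaw t

instance (M : NetworkedMDP N d S A) (t : ℕ) : IsMarkovKernel (M.timeLaw t) := by
  induction t with
  | zero => unfold timeLaw; infer_instance
  | succ t ih => unfold timeLaw; infer_instance

instance (M : NetworkedMDP N d S A) : IsMarkovKernel M.trajKernel := by
  unfold trajKernel
  have : IsMarkovKernel (M.actKernel.map fun x (_ : Finset.Iic 0) => x) :=
    Kernel.IsMarkovKernel.map _ (by fun_prop)
  exact Kernel.IsMarkovKernel.map _ (by fun_prop)

instance (M : NetworkedMDP N d S A) : IsMarkovKernel M.epKernel := by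
  unfold epKernel; infer_instance

instance (M : NetworkedMDP N d S A) (δ : ℝ) : IsMarkovKernel (M.epochKernel δ) := by
  unfold epochKernel; infer_instance

/-- This trades the path-space law for a recursion of kernels, so that time marginals can be treated
by induction on t. -/
theorem trajKernel_map_eval (M : NetworkedMDP N d S A) (t : ℕ) :
    M.trajKernel.map (fun ω => ω t) = (M.timeLaw t).map fun x => (x.1.2, x.2) := by
  have key : ((Kernel.traj (X := fun _ => (Param d × (∀ i, S i)) × (∀ i, A i))
      (fun n => M.timeStep.comap
        (fun h => h ⟨n, Finset.mem_Iic.2 le_rfl⟩) (measurable_pi_apply _)) 0) ∘ₖ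
    (M.actKernel.map fun x (_ : Finset.Iic 0) => x)).map (fun ω => ω t) = M.timeLaw t := by
    rw [Kernel.map_comp]
    induction t with
    | zero =>
      rw [traj_map_eval_zero, Kernel.deterministic_comp_eq_map,
        ← Kernel.map_comp_right _ (by fun_prop) (by fun_prop)]
      exact Kernel.map_id _
    | succ t ih => rw [traj_map_eval_succ, Kernel.comp_assoc, ih]; rfl
  rw [← key, trajKernel, ← Kernel.map_comp_right _ (by fun_prop) (by fun_prop),
    ← Kernel.map_comp_right _ (by fun_prop) (by fun_prop)]
  rfl

theorem integral_trajKernel_eval (M : NetworkedMDP N d S A) (t : ℕ) (p : Param d × (∀ i, S i))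
    {f : (∀ i, S i) × (∀ i, A i) → ℝ} (hf : Measurable f) :
    ∫ ω, f (ω t) ∂(M.trajKernel p) = ∫ x, f (x.1.2, x.2) ∂(M.timeLaw t p) := by
  have h := congrArg (fun κ => κ p) (M.trajKernel_map_eval t)
  rw [Kernel.map_apply _ (by fun_prop), Kernel.map_apply _ (by fun_prop)] at h
  rw [← integral_map (φ := fun ω : ℕ → _ => ω t)
      (measurable_pi_apply t).aemeasurable hf.aestronglyMeasurable, h,
    integral_map (by fun_prop) hf.aestronglyMeasurable]

/-- A set of agents is closed if it contains all agents that influence its members. -/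
def IsClosedSet (M : NetworkedMDP N d S A) (T : Set (Fin N)) : Prop :=
  ∀ i j, M.ESO i j → j ∈ T → i ∈ T

/-- An agent of T observes only agents of T, so the factors of the product law indexed by T agree,
and f sees no other factor. -/
theorem integral_actionKernel_congr (M : NetworkedMDP N d S A) {T : Set (Fin N)}
    (hT : M.IsClosedSet T) {p q : Param d × (∀ i, S i)}
    (h1 : ∀ i ∈ T, p.1.block i = q.1.block i) (h2 : ∀ i ∈ T, p.2 i = q.2 i)
    {f : (∀ i, A i) → ℝ} (hf : Measurable f)
    (hfT : ∀ x y : ∀ i, A i, (∀ i ∈ T, x i = y i) → f x = f y) :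
    ∫ a, f a ∂(M.actionKernel p) = ∫ a, f a ∂(M.actionKernel q) := by
  refine integral_pi_congr_of_dependsOn _ _ T (fun i hi => ?_) hf hfT
  rw [Kernel.comap_apply, Kernel.comap_apply]
  have hs : (fun j : closedIn M.EO i => p.2 j) = fun j : closedIn M.EO i => q.2 j := by
    funext ⟨j, hj⟩
    rcases hj with hj | rfl
    · exact h2 j (hT j i (Or.inr hj) hi)
    · exact h2 _ hi
  simp only [h1 i hi, hs]

theorem integral_transKernel_congr (M : NetworkedMDP N d S A) {T : Set (Fin N)}
    (hT : M.IsClosedSet T) {p q : (∀ i, S i) × (∀ i, A i)}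
    (h1 : ∀ i ∈ T, p.1 i = q.1 i) (h2 : ∀ i ∈ T, p.2 i = q.2 i)
    {f : (∀ i, S i) → ℝ} (hf : Measurable f)
    (hfT : ∀ x y : ∀ i, S i, (∀ i ∈ T, x i = y i) → f x = f y) :
    ∫ a, f a ∂(M.transKernel p) = ∫ a, f a ∂(M.transKernel q) := by
  refine integral_pi_congr_of_dependsOn _ _ T (fun i hi => ?_) hf hfT
  rw [Kernel.comap_apply, Kernel.comap_apply]
  have hj : ∀ j ∈ closedIn M.ES i, j ∈ T := by
    rintro j (hj | rfl)
    · exact hT j i (Or.inl hj) hi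
    · exact hi
  have hs : (fun j : closedIn M.ES i => p.1 j) = fun j : closedIn M.ES i => q.1 j :=
    funext fun j => h1 j (hj j j.2)
  have ha : (fun j : closedIn M.ES i => p.2 j) = fun j : closedIn M.ES i => q.2 j :=
    funext fun j => h2 j (hj j j.2)
  simp only [hs, ha]

theorem integral_actKernel (M : NetworkedMDP N d S A) (p : Param d × (∀ i, S i))
    {f : (Param d × (∀ i, S i)) × (∀ i, A i) → ℝ} (hf : Measurable f) :
    ∫ x, f x ∂(M.actKernel p) = ∫ a, f (p, a) ∂(M.actionKernel p) := by
  rw [actKernel, Kernel.prod_apply, Kernel.id_apply, Measure.dirac_prod,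
    integral_map (by fun_prop) hf.aestronglyMeasurable]

theorem integral_timeStep (M : NetworkedMDP N d S A)
    (x : (Param d × (∀ i, S i)) × (∀ i, A i))
    {f : (Param d × (∀ i, S i)) × (∀ i, A i) → ℝ} (hf : Measurable f) {c : ℝ}
    (hc : ∀ x, |f x| ≤ c) :
    ∫ y, f y ∂(M.timeStep x) =
      ∫ s, ∫ y, f y ∂(M.actKernel (x.1.1, s)) ∂(M.transKernel (x.1.2, x.2)) := by
  have : IsProbabilityMeasure (M.timeStep x) := inferInstance
  rw [timeStep] at this ⊢
  rw [Kernel.integral_comp (integrable_of_abs_le hf hc), Kernel.prod_apply,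
    Kernel.deterministic_apply, Measure.dirac_prod,
    integral_map (by fun_prop) (measurable_integral_kernel _ hf).aestronglyMeasurable]
  rfl

/-- Expectations at time `t` of functions depending on a closed set of agents only depend on the
parameters and initial states of these agents. -/
theorem integral_timeLaw_congr (M : NetworkedMDP N d S A) {T : Set (Fin N)}
    (hT : M.IsClosedSet T) (t : ℕ) {p q : Param d × (∀ i, S i)}
    (h1 : ∀ i ∈ T, p.1.block i = q.1.block i) (h2 : ∀ i ∈ T, p.2 i = q.2 i)
    {f : (Param d × (∀ i, S i)) × (∀ i, A i) → ℝ} (hf : Measurable f) {c : ℝ}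
    (hc : ∀ x, |f x| ≤ c)
    (hfT : ∀ x y : (Param d × (∀ i, S i)) × (∀ i, A i),
      (∀ i ∈ T, x.1.1.block i = y.1.1.block i) → (∀ i ∈ T, x.1.2 i = y.1.2 i) →
      (∀ i ∈ T, x.2 i = y.2 i) → f x = f y) :
    ∫ x, f x ∂(M.timeLaw t p) = ∫ x, f x ∂(M.timeLaw t q) := by
  -- The action draw is isolated because it occurs both at time 0 and as the second half of every
  -- time step.
  have act : ∀ p q : Param d × (∀ i, S i), (∀ i ∈ T, p.1.block i = q.1.block i) →
      (∀ i ∈ T, p.2 i = q.2 i) → ∀ f : (Param d × (∀ i, S i)) × (∀ i, A i) → ℝ, Measurable f →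
      (∀ x y : (Param d × (∀ i, S i)) × (∀ i, A i),
      (∀ i ∈ T, x.1.1.block i = y.1.1.block i) → (∀ i ∈ T, x.1.2 i = y.1.2 i) →
      (∀ i ∈ T, x.2 i = y.2 i) → f x = f y) →
      ∫ x, f x ∂(M.actKernel p) = ∫ x, f x ∂(M.actKernel q) := by
    intro p q h1 h2 f hf hfT
    rw [M.integral_actKernel p hf, M.integral_actKernel q hf]
    have : ∀ a, f (p, a) = f (q, a) := fun a => hfT _ _ h1 h2 fun _ _ => rfl
    simp_rw [this]
    exact M.integral_actionKernel_congr hT h1 h2 (hf.comp (by fun_prop))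
      fun x y hxy => hfT _ _ (fun _ _ => rfl) (fun _ _ => rfl) hxy
  induction t generalizing f with
  | zero => exact act p q h1 h2 f hf hfT
  | succ t ih =>
    have hi : ∀ p, Integrable f ((M.timeStep ∘ₖ M.timeLaw t) p) := fun p =>
      integrable_of_abs_le hf hc
    rw [timeLaw, Kernel.integral_comp (hi p), Kernel.integral_comp (hi q)]
    -- The one-step expectation of f has the same bound and again depends only on T, so the
    -- induction hypothesis is applied to it in place of f.
    refine ih (measurable_integral_kernel _ hf) (fun x => abs_integral_le_of_abs_le hc) ?_
    intro x y hx1 hx2 hx3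
    rw [M.integral_timeStep x hf hc, M.integral_timeStep y hf hc]
    have : ∀ s, ∫ z, f z ∂(M.actKernel (x.1.1, s)) = ∫ z, f z ∂(M.actKernel (y.1.1, s)) :=
      fun s => act (x.1.1, s) (y.1.1, s) hx1 (fun _ _ => rfl) f hf hfT
    simp_rw [this]
    refine M.integral_transKernel_congr hT hx2 hx3
      ((measurable_integral_kernel M.actKernel hf).comp (by fun_prop)) ?_
    exact fun s s' hs => act (y.1.1, s) (y.1.1, s') (fun _ _ => rfl) hs f hf hfT

theorem measurable_reward (M : NetworkedMDP N d S A) (i : Fin N) : Measurable (M.reward i) :=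
  (M.measurable_r i).comp (by fun_prop)

/-- Whatever is influenced by an agent reachable from i is itself reachable. The complement excludes
i, which is why its evolution is blind to θ_i. -/
theorem isClosedSet_not_reach (M : NetworkedMDP N d S A) (i : Fin N) :
    M.IsClosedSet {k | ¬ M.Reach i k} := fun _ _ hjk hk hj => hk (hj.tail hjk)

/-- The discounted sum of the rewards of agent `i` along a trajectory. -/
noncomputable def gain (M : NetworkedMDP N d S A) (i : Fin N)
    (ω : ℕ → (∀ i, S i) × (∀ i, A i)) : ℝ := ∑' t : ℕ, M.γ ^ t * M.reward i (ω t)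

theorem summable_gain (M : NetworkedMDP N d S A) {c : ℝ} (i : Fin N)
    (hc : ∀ x, |M.reward i x| ≤ c) (ω : ℕ → (∀ i, S i) × (∀ i, A i)) :
    Summable fun t : ℕ => M.γ ^ t * M.reward i (ω t) := by
  refine Summable.of_norm_bounded
    ((summable_geometric_of_lt_one M.γ_pos.le M.γ_lt_one).mul_right c) fun t => ?_
  rw [norm_mul, norm_pow, Real.norm_of_nonneg M.γ_pos.le]
  exact mul_le_mul_of_nonneg_left (hc _) (pow_nonneg M.γ_pos.le _)

theorem measurable_gain (M : NetworkedMDP N d S A) {c : ℝ} (i : Fin N)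
    (hc : ∀ x, |M.reward i x| ≤ c) : Measurable (M.gain i) := by
  refine measurable_of_tendsto_metrizable
    (f := fun n ω => ∑ t ∈ Finset.range n, M.γ ^ t * M.reward i (ω t)) (fun n => ?_) ?_
  · exact Finset.measurable_fun_sum _ fun t _ =>
      ((M.measurable_reward i).comp (measurable_pi_apply t)).const_mul _
  · exact tendsto_pi_nhds.2 fun ω => (M.summable_gain i hc ω).hasSum.tendsto_sum_nat

/-- Geometric domination permits the exchange of sum and integral, so value functions are determined
by the time marginals alone. -/
theorem integral_gain (M : NetworkedMDP N d S A) {c : ℝ} (i : Fin N)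
    (hc : ∀ x, |M.reward i x| ≤ c) (p : Param d × (∀ i, S i)) :
    ∫ ω, M.gain i ω ∂(M.trajKernel p) =
      ∑' t : ℕ, M.γ ^ t * ∫ ω, M.reward i (ω t) ∂(M.trajKernel p) := by
  have hm : ∀ t : ℕ, Measurable fun ω : ℕ → (∀ i, S i) × (∀ i, A i) => M.reward i (ω t) :=
    fun t => (M.measurable_reward i).comp (measurable_pi_apply t)
  have hi : ∀ t : ℕ, Integrable (fun ω => M.γ ^ t * M.reward i (ω t)) (M.trajKernel p) :=
    fun t => (integrable_of_abs_le (hm t) fun ω => hc _).const_mul _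
  have := integral_tsum_of_summable_integral_norm hi ?_
  · unfold gain
    rw [← this]
    simp_rw [integral_const_mul]
  · refine Summable.of_nonneg_of_le (fun t => by positivity) (fun t => ?_)
      ((summable_geometric_of_lt_one M.γ_pos.le M.γ_lt_one).mul_right c)
    refine (le_abs_self _).trans (abs_integral_le_of_abs_le fun ω => ?_)
    rw [abs_norm, norm_mul, norm_pow, Real.norm_of_nonneg M.γ_pos.le]
    exact mul_le_mul_of_nonneg_left (hc _) (pow_nonneg M.γ_pos.le _)

/-- The local value function of agent `j` does not depend on the parameter of an agent whose
local value-function group does not contain `j`. -/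
theorem V_congr (M : NetworkedMDP N d S A) {c : ℝ} (i j : Fin N)
    (hc : ∀ x, |M.reward j x| ≤ c) (hj : j ∉ M.IL i) {θ θ' : Param d}
    (h : ∀ k, k ≠ i → θ.block k = θ'.block k) (s : ∀ i, S i) :
    M.V j θ s = M.V j θ' s := by
  have hi : ∀ p, M.V j p s = ∑' t : ℕ, M.γ ^ t * ∫ ω, M.reward j (ω t) ∂(M.trajKernel (p, s)) :=
    fun p => M.integral_gain j hc (p, s)
  rw [hi, hi]
  refine tsum_congr fun t => ?_
  congr 1
  rw [M.integral_trajKernel_eval t _ (M.measurable_reward j),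
    M.integral_trajKernel_eval t _ (M.measurable_reward j)]
  refine M.integral_timeLaw_congr (M.isClosedSet_not_reach i) t (p := (θ, s)) (q := (θ', s))
    (f := fun x => M.reward j (x.1.2, x.2)) (fun k hk => h k ?_) (fun _ _ => rfl) ((M.measurable_reward j).comp (by fun_prop)) (fun _ => hc _) ?_
  · rintro rfl
    exact hk Relation.ReflTransGen.refl
  · intro x y _ h2 h3
    -- That j is not in `IL i` means exactly that no argument of the reward of j is reachable from
    -- i.
    have hR : ∀ k ∈ closedIn M.ER j, k ∈ {k | ¬ M.Reach i k} := fun k hk hr => hj ⟨k, hk, hr⟩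
    have hs : (fun k : closedIn M.ER j => x.1.2 k) = fun k : closedIn M.ER j => y.1.2 k :=
      funext fun k => h2 k (hR k k.2)
    have ha : (fun k : closedIn M.ER j => x.2 k) = fun k : closedIn M.ER j => y.2 k :=
      funext fun k => h3 k (hR k k.2)
    simp only [reward, hs, ha]

end NetworkedMDP

/-! ### Doubly stochastic matrices: contraction towards the average. -/

section Stochastic

/-- The weighted variance identity is kept as an equality because its equality case drives the
strict contraction below. -/
theorem sum_mul_sq_sub_sq {ι : Type*} (s : Finset ι) (p x : ι → ℝ) (hp : ∑ j ∈ s, p j = 1) :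
    ∑ j ∈ s, p j * (x j - ∑ k ∈ s, p k * x k) ^ 2 =
      ∑ j ∈ s, p j * x j ^ 2 - (∑ j ∈ s, p j * x j) ^ 2 := by
  set m := ∑ k ∈ s, p k * x k with hm
  have : ∀ j, p j * (x j - m) ^ 2 = p j * x j ^ 2 - 2 * m * (p j * x j) + m ^ 2 * p j :=
    fun j => by ring
  simp_rw [this]
  rw [Finset.sum_add_distrib, Finset.sum_sub_distrib, ← Finset.mul_sum, ← Finset.mul_sum, hp, ← hm]
  ring

theorem sq_sum_mul_le {ι : Type*} (s : Finset ι) (p x : ι → ℝ) (hp : ∑ j ∈ s, p j = 1)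
    (hp0 : ∀ j ∈ s, 0 ≤ p j) : (∑ j ∈ s, p j * x j) ^ 2 ≤ ∑ j ∈ s, p j * x j ^ 2 := by
  have h := sum_mul_sq_sub_sq s p x hp
  have : 0 ≤ ∑ j ∈ s, p j * (x j - ∑ k ∈ s, p k * x k) ^ 2 :=
    Finset.sum_nonneg fun j hj => mul_nonneg (hp0 j hj) (sq_nonneg _)
  linarith

variable {n : Type*} [Fintype n]

theorem sum_sub_avg_sq [Nonempty n] (x : n → ℝ) (c : ℝ) :
    ∑ i, (x i - c) ^ 2 = ∑ i, (x i - (∑ j, x j) / Fintype.card n) ^ 2 +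
      Fintype.card n * ((∑ j, x j) / Fintype.card n - c) ^ 2 := by
  have hn : (Fintype.card n : ℝ) ≠ 0 := by simp
  set m := (∑ j, x j) / Fintype.card n with hm
  have hs : ∑ j, x j = Fintype.card n * m := by rw [hm]; field_simp
  have : ∀ i, (x i - c) ^ 2 = (x i - m) ^ 2 + (2 * (m - c) * x i + (c ^ 2 - m ^ 2)) :=
    fun i => by ring
  simp_rw [this]
  rw [Finset.sum_add_distrib, Finset.sum_add_distrib, ← Finset.mul_sum, hs, Finset.sum_const,
    Finset.card_univ, nsmul_eq_mul]
  ring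

variable [DecidableEq n]

theorem toEuclideanCLM_sub_avg_apply (A : Matrix n n ℝ) (v : EuclideanSpace ℝ n) (i : n) :
    Matrix.toEuclideanCLM (n := n) (𝕜 := ℝ)
      (A - (1 / (Fintype.card n : ℝ)) • Matrix.of fun _ _ => (1 : ℝ)) v i =
      ∑ j, A i j * v j - (∑ j, v j) / Fintype.card n := by
  rw [Matrix.ofLp_toEuclideanCLM]
  simp only [Matrix.mulVec, dotProduct, Matrix.sub_apply, Matrix.smul_apply, Matrix.of_apply,
    sub_mul, Finset.sum_sub_distrib, smul_eq_mul, mul_one, ← Finset.mul_sum]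
  ring

/-- A unit vector whose norm does not decrease must have zero variance under every row of A. It is
then constant along edges, hence constant by connectedness, and its deviation from its mean
vanishes, a contradiction. -/
theorem norm_sub_avg_lt_one [Nonempty n] {A : Matrix n n ℝ} (hA : A ∈ doublyStochastic ℝ n)
    (G : SimpleGraph n) (hG : G.Connected) (hpos : ∀ i j, i = j ∨ G.Adj i j → 0 < A i j) :
    ‖Matrix.toEuclideanCLM (n := n) (𝕜 := ℝ)
      (A - (1 / (Fintype.card n : ℝ)) • Matrix.of fun _ _ => (1 : ℝ))‖ < 1 := by
  obtain ⟨h0, hrow, hcol⟩ := mem_doublyStochastic_iff_sum.1 hA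
  have hn : (Fintype.card n : ℝ) ≠ 0 := by simp
  set T := Matrix.toEuclideanCLM (n := n) (𝕜 := ℝ)
      (A - (1 / (Fintype.card n : ℝ)) • Matrix.of fun _ _ => (1 : ℝ)) with hT
  have key : ∀ v : EuclideanSpace ℝ n, ‖v‖ = 1 → ‖T v‖ < 1 := by
    intro v hv
    by_contra! hle
    set m := (∑ j, v j) / Fintype.card n with hm
    have hTv : ∀ i, T v i = ∑ j, A i j * (v j - m) := fun i => by
      rw [hT, toEuclideanCLM_sub_avg_apply]
      simp only [mul_sub, Finset.sum_sub_distrib, ← Finset.sum_mul, hrow, one_mul, ← hm]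
    -- The variance identity of each row is summed over the rows; unit column sums then remove A
    -- from the right-hand side.
    have h1 : ∑ i, (T v i) ^ 2 + ∑ i, ∑ j, A i j * ((v j - m) - T v i) ^ 2 =
        ∑ j, (v j - m) ^ 2 := by
      rw [← Finset.sum_add_distrib]
      have : ∀ i, (T v i) ^ 2 + ∑ j, A i j * ((v j - m) - T v i) ^ 2 =
          ∑ j, A i j * (v j - m) ^ 2 := fun i => by
        have := sum_mul_sq_sub_sq Finset.univ (A i) (fun j => v j - m) (hrow i)
        rw [hTv i]; linarith
      simp_rw [this]
      rw [Finset.sum_comm]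
      simp_rw [← Finset.sum_mul, hcol, one_mul]
    have h2 := sum_sub_avg_sq (fun i => v i) 0
    simp only [sub_zero, ← hm] at h2
    have hv2 : ∑ i, (v i) ^ 2 = 1 := by rw [← EuclideanSpace.real_norm_sq_eq, hv]; norm_num
    have hT2 : 1 ≤ ∑ i, (T v i) ^ 2 := by
      rw [← EuclideanSpace.real_norm_sq_eq]; nlinarith [norm_nonneg (T v)]
    have hm2 : 0 ≤ (Fintype.card n : ℝ) * m ^ 2 := by positivity
    have hnn : ∀ i j, 0 ≤ A i j * ((v j - m) - T v i) ^ 2 := fun i j =>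
      mul_nonneg (h0 i j) (sq_nonneg _)
    have hz : ∑ i, ∑ j, A i j * ((v j - m) - T v i) ^ 2 = 0 :=
      le_antisymm (by linarith) (Finset.sum_nonneg fun i _ => Finset.sum_nonneg fun j _ => hnn i j)
    have hz' : ∀ i j, A i j * ((v j - m) - T v i) ^ 2 = 0 := fun i j => by
      have := (Finset.sum_eq_zero_iff_of_nonneg fun i _ =>
        Finset.sum_nonneg fun j _ => hnn i j).1 hz i (Finset.mem_univ i)
      exact (Finset.sum_eq_zero_iff_of_nonneg fun j _ => hnn i j).1 this j (Finset.mem_univ j)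
    have hval : ∀ i j, i = j ∨ G.Adj i j → v j - m = T v i := fun i j hij => by
      have := (mul_eq_zero.1 (hz' i j)).resolve_left (hpos i j hij).ne'
      have := pow_eq_zero_iff (two_ne_zero) |>.1 this
      linarith
    -- The positive diagonal entry ties the common value seen by row i to v i itself, which excludes
    -- period-two behaviour.
    have hadj : ∀ i j, G.Adj i j → v i = v j := fun i j hij => by
      have h3 := hval i i (Or.inl rfl)
      have h4 := hval i j (Or.inr hij)
      linarith
    have hconst : ∀ i j, v i = v j := fun i j => by
      obtain ⟨p⟩ := hG.preconnected i j
      induction p with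
      | nil => rfl
      | cons h p ih => exact (hadj _ _ h).trans ih
    have hvm : ∀ i, v i = m := fun i => by
      rw [hm, Finset.sum_congr rfl fun j _ => hconst j i, Finset.sum_const, Finset.card_univ,
        nsmul_eq_mul]
      field_simp
    have : ∑ j, (v j - m) ^ 2 = 0 := by simp [hvm]
    linarith
  obtain ⟨i₀⟩ := ‹Nonempty n›
  have hne : (Metric.sphere (0 : EuclideanSpace ℝ n) 1).Nonempty :=
    ⟨EuclideanSpace.single i₀ 1, by simp⟩
  -- Compactness makes the norm attained on the sphere, so the strict bound for each vector passes
  -- to the operator norm.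
  obtain ⟨v, hv, hmax⟩ := (isCompact_sphere (0 : EuclideanSpace ℝ n) 1).exists_isMaxOn hne
    (T.continuous.norm.continuousOn)
  refine lt_of_le_of_lt ?_ (key v (by simpa using hv))
  exact T.opNorm_le_of_unit_norm (norm_nonneg _) fun x hx => hmax (by simpa using hx)

/-- The error vector always has sum zero, so the averaging part of the operator annihilates it and
each step multiplies it by the contraction. Any centre c is allowed, since the mean minimises the
sum of squared deviations. -/
theorem abs_pow_mulVec_sub_avg_le [Nonempty n] {A : Matrix n n ℝ}
    (hA : A ∈ doublyStochastic ℝ n) (k : ℕ) (w : n → ℝ) (i : n) (c b : ℝ)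
    (hb : ∀ j, |w j - c| ≤ b) :
    |(A ^ k *ᵥ w) i - (∑ j, w j) / Fintype.card n| ≤
      ‖Matrix.toEuclideanCLM (n := n) (𝕜 := ℝ)
        (A - (1 / (Fintype.card n : ℝ)) • Matrix.of fun _ _ => (1 : ℝ))‖ ^ k *
        (√(Fintype.card n) * b) := by
  have hn : (Fintype.card n : ℝ) ≠ 0 := by simp
  have hb0 : 0 ≤ b := (abs_nonneg _).trans (hb i)
  set T := Matrix.toEuclideanCLM (n := n) (𝕜 := ℝ)
      (A - (1 / (Fintype.card n : ℝ)) • Matrix.of fun _ _ => (1 : ℝ)) with hT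
  set m := (∑ j, w j) / Fintype.card n with hm
  let e : ℕ → EuclideanSpace ℝ n := fun k => WithLp.toLp 2 fun i => (A ^ k *ᵥ w) i - m
  have hsum : ∀ k, ∑ j, e k j = 0 := fun k => by
    simp only [e, Finset.sum_sub_distrib,
      sum_mulVec_of_mem_doublyStochastic (pow_mem hA k), Finset.sum_const, Finset.card_univ,
      nsmul_eq_mul]
    rw [hm]; field_simp; ring
  have hstep : ∀ k, e (k + 1) = T (e k) := fun k => by
    ext i
    rw [hT, toEuclideanCLM_sub_avg_apply, hsum, zero_div, sub_zero]
    simp only [e, mul_sub, Finset.sum_sub_distrib, ← Finset.sum_mul,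
      sum_row_of_mem_doublyStochastic hA, one_mul]
    rw [pow_succ', ← Matrix.mulVec_mulVec]
    rfl
  have hnorm : ‖e k‖ ≤ ‖T‖ ^ k * ‖e 0‖ := by
    induction k with
    | zero => simp
    | succ k ih =>
      rw [hstep, pow_succ', mul_assoc]
      exact (T.le_opNorm _).trans (mul_le_mul_of_nonneg_left ih (norm_nonneg _))
  have h0 : ‖e 0‖ ≤ √(Fintype.card n) * b := by
    refine le_of_sq_le_sq ?_ (by positivity)
    rw [EuclideanSpace.real_norm_sq_eq, mul_pow, Real.sq_sqrt (by positivity)]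
    have h1 := sum_sub_avg_sq w c
    have h2 : ∑ i, (w i - c) ^ 2 ≤ Fintype.card n * b ^ 2 := by
      rw [← nsmul_eq_mul, ← Finset.card_univ, ← Finset.sum_const]
      exact Finset.sum_le_sum fun j _ => sq_le_sq' (abs_le.1 (hb j)).1 (abs_le.1 (hb j)).2
    have h3 : 0 ≤ (Fintype.card n : ℝ) * (m - c) ^ 2 := by positivity
    simp only [e, pow_zero, Matrix.one_mulVec]
    linarith
  calc |(A ^ k *ᵥ w) i - m| = ‖e k i‖ := rfl
    _ ≤ ‖e k‖ := PiLp.norm_apply_le _ _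
    _ ≤ _ := hnorm.trans (mul_le_mul_of_nonneg_left h0 (by positivity))

end Stochastic

/-! ### Consensus within the group of a cluster. -/

namespace NetworkedMDP

variable {N : ℕ} {d : Fin N → ℕ} {S A : Fin N → Type*}
  [∀ i, MeasurableSpace (S i)] [∀ i, MeasurableSpace (A i)]

instance (M : NetworkedMDP N d S A) : Finite M.Cluster := by
  unfold Cluster; infer_instance

theorem nl_le_n0 (M : NetworkedMDP N d S A) (l : M.Cluster) : M.nl l ≤ M.n0 :=
  le_ciSup (Set.finite_range M.nl).bddAbove l

theorem self_mem_Icl (M : NetworkedMDP N d S A) (i : Fin N) : i ∈ M.Icl (M.cluster i) :=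
  (M.mem_Icl_cluster i i).2 ⟨i, Or.inr rfl, Relation.ReflTransGen.refl⟩

theorem Icl_nonempty (M : NetworkedMDP N d S A) (l : M.Cluster) : (M.Icl l).Nonempty := by
  induction l using Quotient.inductionOn with
  | h i => exact ⟨i, M.self_mem_Icl i⟩

theorem one_le_nl (M : NetworkedMDP N d S A) (l : M.Cluster) : 1 ≤ M.nl l :=
  Finset.card_pos.2 (M.Icl_nonempty l)

theorem rhoL_nonneg (M : NetworkedMDP N d S A) (C : M.Cluster → Matrix (Fin N) (Fin N) ℝ)
    (l : M.Cluster) : 0 ≤ M.rhoL C l := norm_nonneg _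

theorem rhoL_le_rho0 (M : NetworkedMDP N d S A) (C : M.Cluster → Matrix (Fin N) (Fin N) ℝ)
    (l : M.Cluster) : M.rhoL C l ≤ M.rho0 C :=
  le_ciSup (Set.finite_range (M.rhoL C)).bddAbove l

theorem rhoL_eq (M : NetworkedMDP N d S A) (C : M.Cluster → Matrix (Fin N) (Fin N) ℝ)
    (l : M.Cluster) : M.rhoL C l = ‖Matrix.toEuclideanCLM (n := M.Icl l) (𝕜 := ℝ)
      (M.C0 C l - (1 / (Fintype.card (M.Icl l) : ℝ)) • Matrix.of fun _ _ => (1 : ℝ))‖ := by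
  rw [Fintype.card_coe]; rfl

theorem rhoL_lt_one (M : NetworkedMDP N d S A) {C : M.Cluster → Matrix (Fin N) (Fin N) ℝ}
    (hC : M.IsConsensusWeights C) (l : M.Cluster)
    (hconn : (M.Gcm.induce (M.Icl l : Set (Fin N))).Connected) : M.rhoL C l < 1 := by
  rw [rhoL_eq]
  have : Nonempty (M.Icl l) := (M.Icl_nonempty l).to_subtype
  refine norm_sub_avg_lt_one (hC.doublyStochastic l)
    (M.Gcm.induce (M.Icl l : Set (Fin N))) hconn fun i j hij => ?_
  refine hC.pos l i j i.2 j.2 (hij.imp (fun h => by rw [h]) fun h => ?_)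
  simpa using h

theorem rho0_lt_one [NeZero N] (M : NetworkedMDP N d S A)
    {C : M.Cluster → Matrix (Fin N) (Fin N) ℝ}
    (hC : M.IsConsensusWeights C)
    (hconn : ∀ l, (M.Gcm.induce (M.Icl l : Set (Fin N))).Connected) : M.rho0 C < 1 := by
  have : Nonempty M.Cluster := ⟨M.cluster 0⟩
  obtain ⟨l, hl⟩ := exists_eq_ciSup_of_finite (f := M.rhoL C)
  rw [rho0, ← hl]
  exact M.rhoL_lt_one hC l (hconn l)

/-- On the group of a cluster the consensus iteration is governed by the principal submatrix. -/
theorem consensus_eq (M : NetworkedMDP N d S A) {C : M.Cluster → Matrix (Fin N) (Fin N) ℝ}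
    (hC : M.IsConsensusWeights C) (Te Tc : ℕ) (l : M.Cluster)
    (ω : ℕ → (∀ i, S i) × (∀ i, A i)) (i : M.Icl l) :
    M.consensus C Te Tc l ω i = ((M.C0 C l) ^ Tc *ᵥ fun j : M.Icl l => M.W Te j ω) i := by
  rw [consensus]
  induction Tc generalizing i with
  | zero => simp
  | succ k ih =>
    rw [Function.iterate_succ_apply', pow_succ', ← Matrix.mulVec_mulVec]
    simp only [Matrix.mulVec, dotProduct] at ih ⊢
    -- A row indexed inside the group has zero weight on every agent outside it, so the values held
    -- there never enter.
    rw [← Finset.sum_subset (Finset.subset_univ (M.Icl l)), ← Finset.sum_coe_sort]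
    · refine Finset.sum_congr rfl fun j _ => ?_
      rw [ih j]
      rfl
    · intro j _ hj
      rw [hC.zero l i j, zero_mul]
      · rintro rfl
        exact hj i.2
      · exact fun h => hj h.2.1

theorem measurable_W (M : NetworkedMDP N d S A) (Te : ℕ) (i : Fin N) : Measurable (M.W Te i) :=
  Finset.measurable_fun_sum _ fun t _ =>
    ((M.measurable_reward i).comp (measurable_pi_apply t)).const_mul _

theorem measurable_consensus (M : NetworkedMDP N d S A)
    (C : M.Cluster → Matrix (Fin N) (Fin N) ℝ) (Te Tc : ℕ) (l : M.Cluster) (i : Fin N) :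
    Measurable fun ω => M.consensus C Te Tc l ω i := by
  unfold consensus
  induction Tc generalizing i with
  | zero =>
    simp only [Function.iterate_zero, id]
    by_cases hi : i ∈ M.Icl l
    · simp only [hi, if_true]; exact M.measurable_W Te i
    · simp only [hi, if_false]; exact measurable_const
  | succ k ih =>
    simp only [Function.iterate_succ_apply', Matrix.mulVec, dotProduct]
    exact Finset.measurable_fun_sum _ fun j _ => (ih j).const_mul _

theorem measurable_oracle (M : NetworkedMDP N d S A)
    (C : M.Cluster → Matrix (Fin N) (Fin N) ℝ) (δ : ℝ) (Te Tc : ℕ) :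
    Measurable fun x : Param d × (ℕ → (∀ i, S i) × (∀ i, A i)) =>
      M.oracle C δ Te Tc x.1 x.2 := by
  unfold oracle
  refine (PiLp.continuous_toLp 2 _).measurable.comp (measurable_pi_lambda _ fun p => ?_)
  have : Measurable fun x : Param d × (ℕ → (∀ i, S i) × (∀ i, A i)) =>
      M.consensus C Te Tc (M.cluster p.1) x.2 p.1 :=
    (M.measurable_consensus C Te Tc (M.cluster p.1) p.1).comp measurable_snd
  refine ((this.const_mul _).div_const _).mul ?_
  fun_prop

/-- The squared consensus estimate is at most a weighted average of the squared observed values. -/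
theorem consensus_sq_le (M : NetworkedMDP N d S A) {C : M.Cluster → Matrix (Fin N) (Fin N) ℝ}
    (hC : M.IsConsensusWeights C) (Te Tc : ℕ) (l : M.Cluster)
    (ω : ℕ → (∀ i, S i) × (∀ i, A i)) (i : M.Icl l) :
    M.consensus C Te Tc l ω i ^ 2 ≤
      ∑ j : M.Icl l, ((M.C0 C l) ^ Tc) i j * M.W Te j ω ^ 2 := by
  rw [M.consensus_eq hC]
  have hP := pow_mem (hC.doublyStochastic l) Tc
  exact sq_sum_mul_le _ _ _ (sum_row_of_mem_doublyStochastic hP i)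
    fun j _ => nonneg_of_mem_doublyStochastic hP

end NetworkedMDP

/-! ### Truncated returns, the objective, and the gradient of its smoothing. -/

namespace NetworkedMDP

variable {N : ℕ} {d : Fin N → ℕ} {S A : Fin N → Type*}
  [∀ i, MeasurableSpace (S i)] [∀ i, MeasurableSpace (A i)]

/-- The centre m is left free: m = 0 bounds the return itself, while the midpoint of the reward
range gives half the range, which the final constants require. -/
theorem abs_W_sub_le (M : NetworkedMDP N d S A) (Te : ℕ) (i : Fin N) {m b : ℝ}
    (hb : ∀ x, |M.reward i x - m| ≤ b * (1 - M.γ)) (ω : ℕ → (∀ i, S i) × (∀ i, A i)) :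
    |M.W Te i ω - ∑ t ∈ Finset.range Te, M.γ ^ t * m| ≤ b := by
  have hγ := M.γ_pos
  have hγ1 : 0 < 1 - M.γ := sub_pos.2 M.γ_lt_one
  have hb0 : 0 ≤ b := by
    have := (abs_nonneg _).trans (hb (ω 0))
    exact nonneg_of_mul_nonneg_left this hγ1
  rw [W, ← Finset.sum_sub_distrib]
  refine (Finset.abs_sum_le_sum_abs _ _).trans ?_
  calc ∑ t ∈ Finset.range Te, |M.γ ^ t * M.reward i (ω t) - M.γ ^ t * m|
      ≤ ∑ t ∈ Finset.range Te, M.γ ^ t * (b * (1 - M.γ)) := by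
        refine Finset.sum_le_sum fun t _ => ?_
        rw [← mul_sub, abs_mul, abs_of_pos (pow_pos hγ t)]
        exact mul_le_mul_of_nonneg_left (hb _) (pow_pos hγ t).le
    _ = b * (1 - M.γ ^ Te) := by
        rw [← Finset.sum_mul, geom_sum_eq M.γ_lt_one.ne]
        have : M.γ - 1 ≠ 0 := by linarith
        field_simp
        ring
    _ ≤ b := by nlinarith [pow_pos hγ Te]

theorem abs_W_le (M : NetworkedMDP N d S A) (Te : ℕ) (i : Fin N) {J0 : ℝ}
    (hb : ∀ x, |M.reward i x| ≤ J0 * (1 - M.γ)) (ω : ℕ → (∀ i, S i) × (∀ i, A i)) :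
    |M.W Te i ω| ≤ J0 := by
  simpa using M.abs_W_sub_le Te i (m := 0) (b := J0) (by simpa using hb) ω

theorem abs_gain_sub_W_le (M : NetworkedMDP N d S A) (Te : ℕ) (i : Fin N) {J0 : ℝ}
    (hb : ∀ x, |M.reward i x| ≤ J0 * (1 - M.γ)) (ω : ℕ → (∀ i, S i) × (∀ i, A i)) :
    |M.gain i ω - M.W Te i ω| ≤ M.γ ^ Te * J0 := by
  have hγ := M.γ_pos
  have hγ1 : 0 < 1 - M.γ := sub_pos.2 M.γ_lt_one
  have hs := M.summable_gain i hb ω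
  have h1 : M.gain i ω - M.W Te i ω = ∑' t : ℕ, M.γ ^ (t + Te) * M.reward i (ω (t + Te)) := by
    rw [gain, W, ← hs.sum_add_tsum_nat_add Te]
    ring
  have h2 : HasSum (fun t : ℕ => M.γ ^ t * (M.γ ^ Te * (J0 * (1 - M.γ)))) (M.γ ^ Te * J0) := by
    have := (hasSum_geometric_of_lt_one hγ.le M.γ_lt_one).mul_right (M.γ ^ Te * (J0 * (1 - M.γ)))
    convert! this using 1
    field_simp
  rw [h1]
  refine tsum_of_norm_bounded (f := fun t : ℕ => M.γ ^ (t + Te) * M.reward i (ω (t + Te))) h2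
    fun t => ?_
  rw [Real.norm_eq_abs, abs_mul, abs_of_pos (pow_pos hγ _), pow_add, mul_assoc]
  have := hb (ω (t + Te))
  gcongr

theorem abs_gain_le (M : NetworkedMDP N d S A) (i : Fin N) {J0 : ℝ}
    (hb : ∀ x, |M.reward i x| ≤ J0 * (1 - M.γ)) (ω : ℕ → (∀ i, S i) × (∀ i, A i)) :
    |M.gain i ω| ≤ J0 := by
  simpa [W] using M.abs_gain_sub_W_le 0 i hb ω

theorem gain_le (M : NetworkedMDP N d S A) (i : Fin N) {c ru : ℝ}
    (hc : ∀ x, |M.reward i x| ≤ c) (hu : ∀ x, M.reward i x ≤ ru)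
    (ω : ℕ → (∀ i, S i) × (∀ i, A i)) : M.gain i ω ≤ ru / (1 - M.γ) := by
  have h := (hasSum_geometric_of_lt_one M.γ_pos.le M.γ_lt_one).mul_right ru
  rw [div_eq_inv_mul, ← h.tsum_eq]
  exact (M.summable_gain i hc ω).tsum_le_tsum
    (fun t => mul_le_mul_of_nonneg_left (hu _) (pow_pos M.γ_pos t).le) h.summable

/-- The expected discounted sum of the rewards of agent `i`. -/
noncomputable def localJ (M : NetworkedMDP N d S A) (i : Fin N) (θ : Param d) : ℝ :=
  ∫ ω, M.gain i ω ∂(M.epKernel θ)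

theorem integral_epKernel (M : NetworkedMDP N d S A) (θ : Param d)
    {f : (ℕ → (∀ i, S i) × (∀ i, A i)) → ℝ} (hf : Measurable f) {c : ℝ} (hc : ∀ ω, |f ω| ≤ c) :
    ∫ ω, f ω ∂(M.epKernel θ) = ∫ s, ∫ ω, f ω ∂(M.trajKernel (θ, s)) ∂M.D := by
  have : IsProbabilityMeasure (M.epKernel θ) := inferInstance
  rw [epKernel] at this ⊢
  rw [Kernel.integral_comp (integrable_of_abs_le hf hc), Kernel.prod_apply, Kernel.id_apply,
    Kernel.const_apply, Measure.dirac_prod,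
    integral_map (by fun_prop) (measurable_integral_kernel _ hf).aestronglyMeasurable]

theorem measurable_localJ (M : NetworkedMDP N d S A) (i : Fin N) {c : ℝ}
    (hc : ∀ x, |M.reward i x| ≤ c) : Measurable (M.localJ i) :=
  measurable_integral_kernel _ (M.measurable_gain i hc)

theorem abs_localJ_le (M : NetworkedMDP N d S A) (i : Fin N) {J0 : ℝ}
    (hb : ∀ x, |M.reward i x| ≤ J0 * (1 - M.γ)) (θ : Param d) : |M.localJ i θ| ≤ J0 :=
  abs_integral_le_of_abs_le (M.abs_gain_le i hb)

theorem localJ_le (M : NetworkedMDP N d S A) (i : Fin N) {J0 ru : ℝ}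
    (hb : ∀ x, |M.reward i x| ≤ J0 * (1 - M.γ)) (hu : ∀ x, M.reward i x ≤ ru) (θ : Param d) :
    M.localJ i θ ≤ ru / (1 - M.γ) := by
  have := integral_mono (μ := M.epKernel θ)
    (integrable_of_abs_le (M.measurable_gain i hb) (M.abs_gain_le i hb))
    (integrable_const (ru / (1 - M.γ))) (M.gain_le i hb hu)
  simpa [localJ] using this

theorem localJ_eq (M : NetworkedMDP N d S A) (i : Fin N) {J0 : ℝ}
    (hb : ∀ x, |M.reward i x| ≤ J0 * (1 - M.γ)) (θ : Param d) :
    M.localJ i θ = ∫ s, M.V i θ s ∂M.D :=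
  M.integral_epKernel θ (M.measurable_gain i hb) (M.abs_gain_le i hb)

theorem integrable_V (M : NetworkedMDP N d S A) (i : Fin N) {J0 : ℝ}
    (hb : ∀ x, |M.reward i x| ≤ J0 * (1 - M.γ)) (θ : Param d) :
    Integrable (M.V i θ) M.D := by
  refine integrable_of_abs_le (c := J0) ?_ fun s => abs_integral_le_of_abs_le (M.abs_gain_le i hb)
  exact (measurable_integral_kernel M.trajKernel (M.measurable_gain i hb)).comp
    (measurable_prodMk_left (x := θ))

theorem abs_localJ_sub_le (M : NetworkedMDP N d S A) (i : Fin N) {J0 : ℝ}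
    (hb : ∀ x, |M.reward i x| ≤ J0 * (1 - M.γ)) {K : ℝ}
    (hLip : ∀ s θ θ', |M.V i θ s - M.V i θ' s| ≤ K * ‖θ - θ'‖) (θ θ' : Param d) :
    |M.localJ i θ - M.localJ i θ'| ≤ K * ‖θ - θ'‖ := by
  rw [M.localJ_eq i hb, M.localJ_eq i hb,
    ← integral_sub (M.integrable_V i hb θ) (M.integrable_V i hb θ')]
  exact abs_integral_le_of_abs_le fun s => hLip s θ θ'

theorem localJ_congr (M : NetworkedMDP N d S A) (i j : Fin N) {J0 : ℝ}
    (hb : ∀ x, |M.reward j x| ≤ J0 * (1 - M.γ)) (hj : j ∉ M.IL i) {θ θ' : Param d}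
    (h : ∀ k, k ≠ i → θ.block k = θ'.block k) : M.localJ j θ = M.localJ j θ' := by
  rw [M.localJ_eq j hb, M.localJ_eq j hb]
  exact integral_congr_ae (ae_of_all _ fun s => M.V_congr i j hb hj h s)

theorem J_eq (M : NetworkedMDP N d S A) {J0 : ℝ}
    (hb : ∀ i x, |M.reward i x| ≤ J0 * (1 - M.γ)) (θ : Param d) :
    M.J θ = ∑ i, M.localJ i θ := by
  have h1 : ∀ s, M.globalV θ s = ∑ i, M.V i θ s := fun s => by
    rw [globalV]
    have : ∀ ω : ℕ → (∀ i, S i) × (∀ i, A i),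
        ∑' t : ℕ, M.γ ^ t * ∑ i, M.reward i (ω t) = ∑ i, M.gain i ω := fun ω => by
      simp_rw [Finset.mul_sum]
      exact Summable.tsum_finsetSum fun i _ => M.summable_gain i (hb i) ω
    simp_rw [this]
    exact integral_finsetSum _ fun i _ =>
      integrable_of_abs_le (M.measurable_gain i (hb i)) (M.abs_gain_le i (hb i))
  rw [J]
  simp_rw [h1]
  rw [integral_finsetSum _ fun i _ => M.integrable_V i (hb i) θ]
  exact Finset.sum_congr rfl fun i _ => (M.localJ_eq i (hb i) θ).symm

theorem measurable_J (M : NetworkedMDP N d S A) {J0 : ℝ}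
    (hb : ∀ i x, |M.reward i x| ≤ J0 * (1 - M.γ)) : Measurable M.J := by
  rw [funext (M.J_eq hb)]
  exact Finset.measurable_fun_sum _ fun i _ => M.measurable_localJ i (hb i)

theorem abs_J_le (M : NetworkedMDP N d S A) {J0 : ℝ}
    (hb : ∀ i x, |M.reward i x| ≤ J0 * (1 - M.γ)) (θ : Param d) : |M.J θ| ≤ N * J0 := by
  rw [M.J_eq hb]
  refine (Finset.abs_sum_le_sum_abs _ _).trans ?_
  refine (Finset.sum_le_sum fun i _ => M.abs_localJ_le i (hb i) θ).trans ?_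
  simp

theorem J_le (M : NetworkedMDP N d S A) {J0 ru : ℝ}
    (hb : ∀ i x, |M.reward i x| ≤ J0 * (1 - M.γ)) (hu : ∀ i x, M.reward i x ≤ ru) (θ : Param d) :
    M.J θ ≤ N * (ru / (1 - M.γ)) := by
  rw [M.J_eq hb]
  refine (Finset.sum_le_sum fun i _ => M.localJ_le i (hb i) (hu i) θ).trans ?_
  simp

theorem abs_J_sub_le (M : NetworkedMDP N d S A) {J0 : ℝ}
    (hb : ∀ i x, |M.reward i x| ≤ J0 * (1 - M.γ)) {Lip : Fin N → ℝ}
    (hLip : ∀ i s θ θ', |M.V i θ s - M.V i θ' s| ≤ Lip i * ‖θ - θ'‖) (θ θ' : Param d) :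
    |M.J θ - M.J θ'| ≤ (∑ i, Lip i) * ‖θ - θ'‖ := by
  rw [M.J_eq hb, M.J_eq hb, ← Finset.sum_sub_distrib, Finset.sum_mul]
  exact (Finset.abs_sum_le_sum_abs _ _).trans
    (Finset.sum_le_sum fun i _ => M.abs_localJ_sub_le i (hb i) (hLip i) θ θ')

theorem Jsmooth_le (M : NetworkedMDP N d S A) {J0 ru : ℝ}
    (hb : ∀ i x, |M.reward i x| ≤ J0 * (1 - M.γ)) (hu : ∀ i x, M.reward i x ≤ ru) (δ : ℝ)
    (θ : Param d) : M.Jsmooth δ θ ≤ N * (ru / (1 - M.γ)) := by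
  have := integral_mono (μ := stdGaussian (Param d))
    (integrable_of_abs_le (f := fun u => M.J (θ + δ • u)) ((M.measurable_J hb).comp (by fun_prop))
      fun u => M.abs_J_le hb _)
    (integrable_const (N * (ru / (1 - M.γ)))) (fun u => M.J_le hb hu (θ + δ • u))
  simpa [Jsmooth] using this

theorem abs_Jsmooth_le (M : NetworkedMDP N d S A) {J0 : ℝ}
    (hb : ∀ i x, |M.reward i x| ≤ J0 * (1 - M.γ)) (δ : ℝ) (θ : Param d) :
    |M.Jsmooth δ θ| ≤ N * J0 :=
  abs_integral_le_of_abs_le fun _ => M.abs_J_le hb _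

theorem abs_Jsmooth_sub_le (M : NetworkedMDP N d S A) {J0 : ℝ}
    (hb : ∀ i x, |M.reward i x| ≤ J0 * (1 - M.γ)) {L : ℝ} (hL0 : 0 ≤ L)
    (hL : ∀ θ θ', |M.J θ - M.J θ'| ≤ L * ‖θ - θ'‖) {δ : ℝ} (hδ : 0 ≤ δ) (θ : Param d) :
    |M.Jsmooth δ θ - M.J θ| ≤ L * δ * √(∑ i, d i : ℕ) := by
  have hi : Integrable (fun u => M.J (θ + δ • u)) (stdGaussian (Param d)) :=
    integrable_of_abs_le ((M.measurable_J hb).comp (by fun_prop)) fun u => M.abs_J_le hb _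
  have h1 : M.Jsmooth δ θ - M.J θ = ∫ u, (M.J (θ + δ • u) - M.J θ) ∂(stdGaussian (Param d)) := by
    rw [integral_sub hi (integrable_const _)]
    simp [Jsmooth]
  rw [h1]
  refine (abs_integral_le_integral_abs).trans ?_
  calc _ ≤ ∫ u, L * δ * ‖u‖ ∂(stdGaussian (Param d)) := by
        refine integral_mono (hi.sub (integrable_const _)).abs
          (integrable_norm_stdGaussian.const_mul _) fun u => ?_
        refine (hL _ _).trans_eq ?_
        rw [add_sub_cancel_left, norm_smul, Real.norm_of_nonneg hδ, mul_assoc]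
    _ ≤ _ := by
        rw [integral_const_mul]
        refine mul_le_mul_of_nonneg_left ?_ (by positivity)
        refine integral_norm_stdGaussian_le.trans_eq ?_
        simp

theorem hasGradientAt_Jsmooth (M : NetworkedMDP N d S A) {J0 : ℝ}
    (hb : ∀ i x, |M.reward i x| ≤ J0 * (1 - M.γ)) {δ : ℝ} (hδ : 0 < δ) (θ : Param d) :
    HasGradientAt (M.Jsmooth δ)
      (∫ u, (M.J (θ + δ • u) / δ) • u ∂(stdGaussian (Param d))) θ :=
  hasGradientAt_gaussian_smoothing (M.measurable_J hb) (M.abs_J_le hb) hδ θ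

theorem integrable_shift_smul (δ : ℝ) (θ : Param d) {f : Param d → ℝ} (hf : Measurable f) {c : ℝ}
    (hc : ∀ x, |f x| ≤ c) :
    Integrable (fun u => (f (θ + δ • u) / δ) • u) (stdGaussian (Param d)) :=
  integrable_smul_id_stdGaussian (f := fun u => f (θ + δ • u) / δ) (c := c / |δ|)
    ((hf.comp (by fun_prop)).div_const δ) fun x => by
      rw [abs_div]; exact div_le_div_of_nonneg_right (hc _) (abs_nonneg _)

theorem gradient_Jsmooth (M : NetworkedMDP N d S A) {J0 : ℝ}
    (hb : ∀ i x, |M.reward i x| ≤ J0 * (1 - M.γ)) {δ : ℝ} (hδ : 0 < δ) (θ : Param d) :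
    gradient (M.Jsmooth δ) θ = ∫ u, (M.J (θ + δ • u) / δ) • u ∂(stdGaussian (Param d)) :=
  (M.hasGradientAt_Jsmooth hb hδ θ).gradient

/-- The factor √d in the size and in the Lipschitz constant of the gradient comes from E‖u‖ ≤ √d
used here. -/
theorem norm_integral_smul_le {f : Param d → ℝ} {c : ℝ} (hc : ∀ u, |f u| ≤ c) :
    ‖∫ u, f u • u ∂(stdGaussian (Param d))‖ ≤ c * √(∑ i, d i : ℕ) := by
  have hc0 : 0 ≤ c := (abs_nonneg _).trans (hc 0)
  refine (norm_integral_le_of_norm_le (integrable_norm_stdGaussian.const_mul c)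
    (ae_of_all _ fun u => ?_)).trans ?_
  · rw [norm_smul]
    exact mul_le_mul_of_nonneg_right (hc u) (norm_nonneg _)
  · rw [integral_const_mul]
    refine mul_le_mul_of_nonneg_left (integral_norm_stdGaussian_le.trans_eq ?_) hc0
    simp

theorem norm_gradient_Jsmooth_le (M : NetworkedMDP N d S A) {J0 : ℝ}
    (hb : ∀ i x, |M.reward i x| ≤ J0 * (1 - M.γ)) {δ : ℝ} (hδ : 0 < δ) (θ : Param d) :
    ‖gradient (M.Jsmooth δ) θ‖ ≤ N * J0 / δ * √(∑ i, d i : ℕ) := by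
  rw [M.gradient_Jsmooth hb hδ]
  refine norm_integral_smul_le fun u => ?_
  rw [abs_div, abs_of_pos hδ]
  exact div_le_div_of_nonneg_right (M.abs_J_le hb _) hδ.le

/-- Both gradients are integrals over the same u, so their difference has the scalar weight (J(θ +
δu) - J(θ' + δu))/δ, and a Lipschitz J suffices. -/
theorem norm_gradient_Jsmooth_sub_le (M : NetworkedMDP N d S A) {J0 : ℝ}
    (hb : ∀ i x, |M.reward i x| ≤ J0 * (1 - M.γ)) {L : ℝ}
    (hL : ∀ θ θ', |M.J θ - M.J θ'| ≤ L * ‖θ - θ'‖) {δ : ℝ} (hδ : 0 < δ) (θ θ' : Param d) :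
    ‖gradient (M.Jsmooth δ) θ - gradient (M.Jsmooth δ) θ'‖ ≤
      L * √(∑ i, d i : ℕ) / δ * ‖θ - θ'‖ := by
  rw [M.gradient_Jsmooth hb hδ, M.gradient_Jsmooth hb hδ,
    ← integral_sub (integrable_shift_smul δ θ (M.measurable_J hb) (M.abs_J_le hb))
      (integrable_shift_smul δ θ' (M.measurable_J hb) (M.abs_J_le hb))]
  simp_rw [← sub_smul, ← sub_div]
  refine (norm_integral_smul_le (c := L * ‖θ - θ'‖ / δ) fun u => ?_).trans_eq (by ring)
  rw [abs_div, abs_of_pos hδ]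
  refine div_le_div_of_nonneg_right ((hL _ _).trans_eq ?_) hδ.le
  rw [add_sub_add_right_eq_sub]

theorem integrable_shift_mul_apply (δ : ℝ) (θ : Param d) {f : Param d → ℝ} (hf : Measurable f)
    {c : ℝ} (hc : ∀ x, |f x| ≤ c) (p : Σ i, Fin (d i)) :
    Integrable (fun u => f (θ + δ • u) / δ * u p) (stdGaussian (Param d)) := by
  have := (EuclideanSpace.proj (𝕜 := ℝ) p).integrable_comp (integrable_shift_smul δ θ hf hc)
  simpa using this

theorem integral_shift_smul_apply (δ : ℝ) (θ : Param d) {f : Param d → ℝ} (hf : Measurable f)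
    {c : ℝ} (hc : ∀ x, |f x| ≤ c) (p : Σ i, Fin (d i)) :
    (∫ u, (f (θ + δ • u) / δ) • u ∂(stdGaussian (Param d))) p =
      ∫ u, f (θ + δ • u) / δ * u p ∂(stdGaussian (Param d)) := by
  have := (EuclideanSpace.proj (𝕜 := ℝ) p).integral_comp_comm (integrable_shift_smul δ θ hf hc)
  simpa using this.symm

/-- Agents outside the local value-function group of agent `i` do not contribute to the partial
gradient with respect to the parameter of agent `i`. -/
theorem integral_localJ_mul_eq_zero (M : NetworkedMDP N d S A) (i j : Fin N) {J0 : ℝ}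
    (hb : ∀ x, |M.reward j x| ≤ J0 * (1 - M.γ)) (hj : j ∉ M.IL i) {δ : ℝ} (hδ : 0 < δ)
    (θ : Param d) (k : Fin (d i)) :
    ∫ u, M.localJ j (θ + δ • u) / δ * u ⟨i, k⟩ ∂(stdGaussian (Param d)) = 0 := by
  classical
  have hm := M.measurable_localJ j hb
  have ha := M.abs_localJ_le j hb
  rw [← integral_shift_smul_apply δ θ hm ha]
  have hg := (hasGradientAt_gaussian_smoothing hm ha hδ θ).hasFDerivAt
  set v := ∫ u, (M.localJ j (θ + δ • u) / δ) • u ∂(stdGaussian (Param d)) with hv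
  let e : Param d := EuclideanSpace.single ⟨i, k⟩ 1
  have h1 := hg.hasLineDerivAt e
  -- Moving along e changes only the block of agent i, which `localJ j` ignores; the directional
  -- derivative is thus 0, and by the gradient formula it equals the integral sought.
  have hconst : ∀ t : ℝ, ∫ u, M.localJ j (θ + t • e + δ • u) ∂(stdGaussian (Param d)) =
      ∫ u, M.localJ j (θ + δ • u) ∂(stdGaussian (Param d)) := fun t => by
    refine integral_congr_ae (ae_of_all _ fun u => M.localJ_congr i j hb hj fun m hm => ?_)
    ext q
    simp [Param.block, e, hm]
  have h2 : HasDerivAt (fun t : ℝ => ∫ u, M.localJ j (θ + t • e + δ • u) ∂(stdGaussian (Param d)))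
      0 0 := by
    simp_rw [hconst]
    exact hasDerivAt_const _ _
  have h3 := h1.unique h2
  simpa [e, EuclideanSpace.inner_single_right] using h3

/-- Locality makes a group-wise oracle legitimate: the terms dropped from the global return
integrate to zero against the coordinates of u belonging to this agent. -/
theorem gradient_Jsmooth_apply (M : NetworkedMDP N d S A) {J0 : ℝ}
    (hb : ∀ i x, |M.reward i x| ≤ J0 * (1 - M.γ)) {δ : ℝ} (hδ : 0 < δ) (θ : Param d)
    (p : Σ i, Fin (d i)) :
    gradient (M.Jsmooth δ) θ p =
      ∫ u, (∑ j ∈ M.Icl (M.cluster p.1), M.localJ j (θ + δ • u)) / δ * u p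
        ∂(stdGaussian (Param d)) := by
  rw [M.gradient_Jsmooth hb hδ, integral_shift_smul_apply δ θ (M.measurable_J hb) (M.abs_J_le hb)]
  have hi : ∀ j, Integrable (fun u => M.localJ j (θ + δ • u) / δ * u p) (stdGaussian (Param d)) :=
    fun j => integrable_shift_mul_apply δ θ (M.measurable_localJ j (hb j))
      (M.abs_localJ_le j (hb j)) p
  simp_rw [M.J_eq hb, Finset.sum_div, Finset.sum_mul]
  rw [integral_finsetSum _ fun j _ => hi j, integral_finsetSum _ fun j _ => hi j]
  refine (Finset.sum_subset (Finset.subset_univ _) fun j _ hj => ?_).symm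
  exact M.integral_localJ_mul_eq_zero p.1 j (hb j)
    (fun h => hj ((M.mem_Icl_cluster p.1 j).2 h)) hδ θ p.2

end NetworkedMDP

/-- The descent lemma: a function with Lipschitz gradient is bounded below by its quadratic
model. -/
theorem le_of_lipschitz_gradient {E : Type*} [NormedAddCommGroup E] [InnerProductSpace ℝ E]
    [CompleteSpace E] {G : E → ℝ} (hG : Differentiable ℝ G) {Λ : ℝ}
    (hΛ : ∀ x y, ‖gradient G x - gradient G y‖ ≤ Λ * ‖x - y‖) (x z : E) :
    G x + inner ℝ (gradient G x) z - Λ / 2 * ‖z‖ ^ 2 ≤ G (x + z) := by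
  -- The quadratic term compensates the largest possible drift of the gradient along the segment, so
  -- ψ is nondecreasing and the claim is ψ 0 ≤ ψ 1.
  let ψ : ℝ → ℝ := fun t => G (x + t • z) - t * inner ℝ (gradient G x) z + Λ / 2 * ‖z‖ ^ 2 * t ^ 2
  have hψ : ∀ t, HasDerivAt ψ (inner ℝ (gradient G (x + t • z)) z - inner ℝ (gradient G x) z +
      Λ * ‖z‖ ^ 2 * t) t := by
    intro t
    have h1 : HasDerivAt (fun t : ℝ => x + t • z) z t := by
      simpa using ((hasDerivAt_id t).smul_const z).const_add x
    have h2 := (hG (x + t • z)).hasGradientAt.hasFDerivAt.comp_hasDerivAt t h1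
    have h3 := (hasDerivAt_id t).mul_const (inner ℝ (gradient G x) z)
    have h4 := (hasDerivAt_pow 2 t).const_mul (Λ / 2 * ‖z‖ ^ 2)
    refine ((h2.sub h3).add h4).congr_deriv ?_
    simp
    ring
  have hmono : MonotoneOn ψ (Set.Icc 0 1) := by
    refine monotoneOn_of_deriv_nonneg (convex_Icc 0 1)
      (fun t _ => (hψ t).continuousAt.continuousWithinAt)
      (fun t _ => (hψ t).differentiableAt.differentiableWithinAt) fun t ht => ?_
    rw [interior_Icc] at ht
    rw [(hψ t).deriv, ← inner_sub_left]
    have h1 := abs_le.1 (abs_real_inner_le_norm (gradient G (x + t • z) - gradient G x) z)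
    have h2 := hΛ (x + t • z) x
    rw [add_sub_cancel_left, norm_smul, Real.norm_of_nonneg ht.1.le] at h2
    have h3 := mul_le_mul_of_nonneg_right h2 (norm_nonneg z)
    nlinarith [h1.1]
  have := hmono (Set.left_mem_Icc.2 zero_le_one) (Set.right_mem_Icc.2 zero_le_one) zero_le_one
  simp only [ψ, zero_smul, one_smul, add_zero] at this
  linarith

/-! ### Bias and second moment of the zeroth-order oracle. -/

namespace NetworkedMDP

variable {N : ℕ} {d : Fin N → ℕ} {S A : Fin N → Type*}
  [∀ i, MeasurableSpace (S i)] [∀ i, MeasurableSpace (A i)]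

theorem epochKernel_apply (M : NetworkedMDP N d S A) (δ : ℝ) (θ : Param d) :
    M.epochKernel δ θ = stdGaussian (Param d) ⊗ₘ
      M.epKernel.comap (fun u => θ + δ • u) (by fun_prop) := by
  rw [epochKernel, Kernel.compProd_apply_eq_compProd_sectR, Kernel.const_apply]
  rfl

theorem integral_epochKernel (M : NetworkedMDP N d S A) (δ : ℝ) (θ : Param d)
    {f : Param d × (ℕ → (∀ i, S i) × (∀ i, A i)) → ℝ} (hf : Integrable f (M.epochKernel δ θ)) :
    ∫ x, f x ∂(M.epochKernel δ θ) =
      ∫ u, ∫ ω, f (u, ω) ∂(M.epKernel (θ + δ • u)) ∂(stdGaussian (Param d)) := by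
  rw [epochKernel_apply] at hf ⊢
  rw [Measure.integral_compProd hf]
  rfl

theorem integrable_epochKernel_of_fst (M : NetworkedMDP N d S A) (δ : ℝ) (θ : Param d)
    {f : Param d → ℝ} (hf : Integrable f (stdGaussian (Param d))) :
    Integrable (fun x => f x.1) (M.epochKernel δ θ) := by
  have h : (M.epochKernel δ θ).map Prod.fst = stdGaussian (Param d) := by
    rw [epochKernel_apply]
    exact Measure.fst_compProd _ _
  have h2 : Integrable f ((M.epochKernel δ θ).map Prod.fst) := by rwa [h]
  exact h2.comp_measurable measurable_fst

theorem consensus_abs_le (M : NetworkedMDP N d S A) {C : M.Cluster → Matrix (Fin N) (Fin N) ℝ}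
    (hC : M.IsConsensusWeights C) {J0 : ℝ} (hb : ∀ i x, |M.reward i x| ≤ J0 * (1 - M.γ))
    (Te Tc : ℕ) (l : M.Cluster) (ω : ℕ → (∀ i, S i) × (∀ i, A i)) (i : M.Icl l) :
    |M.consensus C Te Tc l ω i| ≤ J0 := by
  have hJ : 0 ≤ J0 := (abs_nonneg _).trans (M.abs_W_le Te i (hb i) ω)
  have hP := pow_mem (hC.doublyStochastic l) Tc
  refine abs_le_of_sq_le_sq ((M.consensus_sq_le hC Te Tc l ω i).trans ?_) hJ
  calc _ ≤ ∑ j : M.Icl l, ((M.C0 C l) ^ Tc) i j * J0 ^ 2 := by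
        refine Finset.sum_le_sum fun j _ => mul_le_mul_of_nonneg_left ?_
          (nonneg_of_mem_doublyStochastic hP)
        exact sq_le_sq' (abs_le.1 (M.abs_W_le Te j (hb j) ω)).1
          (abs_le.1 (M.abs_W_le Te j (hb j) ω)).2
    _ = J0 ^ 2 := by rw [← Finset.sum_mul, sum_row_of_mem_doublyStochastic hP, one_mul]

/-- The distance between the consensus estimate and the discounted sum of all rewards in the group
of a cluster. -/
theorem abs_consensus_sub_gain_le (M : NetworkedMDP N d S A)
    {C : M.Cluster → Matrix (Fin N) (Fin N) ℝ} (hC : M.IsConsensusWeights C) {J0 m b : ℝ}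
    (hb : ∀ i x, |M.reward i x| ≤ J0 * (1 - M.γ))
    (hm : ∀ i x, |M.reward i x - m| ≤ b * (1 - M.γ))
    (Te Tc : ℕ) (l : M.Cluster) (ω : ℕ → (∀ i, S i) × (∀ i, A i)) (i : M.Icl l) :
    |M.nl l * M.consensus C Te Tc l ω i - ∑ j ∈ M.Icl l, M.gain j ω| ≤
      M.n0 * (M.rho0 C ^ Tc * (√M.n0 * b)) + M.n0 * (M.γ ^ Te * J0) := by
  have : Nonempty (M.Icl l) := ⟨i⟩
  have hn1 : (1 : ℝ) ≤ M.nl l := by exact_mod_cast M.one_le_nl l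
  have hn0 : (M.nl l : ℝ) ≤ M.n0 := by exact_mod_cast M.nl_le_n0 l
  have hJ : 0 ≤ J0 := (abs_nonneg _).trans (M.abs_W_le Te i (hb i) ω)
  have hγ := M.γ_pos
  have hb0 : 0 ≤ b := (abs_nonneg _).trans (M.abs_W_sub_le Te i (hm i) ω)
  have h1 := abs_pow_mulVec_sub_avg_le (hC.doublyStochastic l) Tc
    (fun j : M.Icl l => M.W Te j ω) i (∑ t ∈ Finset.range Te, M.γ ^ t * m) b
    fun j => M.abs_W_sub_le Te j (hm j) ω
  rw [← M.consensus_eq hC, ← M.rhoL_eq C l, Fintype.card_coe, ← nl,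
    Finset.sum_coe_sort (M.Icl l) fun j => M.W Te j ω] at h1
  -- The error splits into the deviation of the estimate from the group average, controlled by Tc,
  -- and the truncated tails, controlled by Te.
  have h2 : M.nl l * M.consensus C Te Tc l ω i - ∑ j ∈ M.Icl l, M.gain j ω =
      M.nl l * (M.consensus C Te Tc l ω i - (∑ j ∈ M.Icl l, M.W Te j ω) / M.nl l) -
        ∑ j ∈ M.Icl l, (M.gain j ω - M.W Te j ω) := by
    rw [Finset.sum_sub_distrib]
    field_simp
    ring
  have h3 : |∑ j ∈ M.Icl l, (M.gain j ω - M.W Te j ω)| ≤ M.nl l * (M.γ ^ Te * J0) := by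
    refine (Finset.abs_sum_le_sum_abs _ _).trans ?_
    refine (Finset.sum_le_sum fun j _ => M.abs_gain_sub_W_le Te j (hb j) ω).trans ?_
    rw [Finset.sum_const, nsmul_eq_mul, nl]
  rw [h2]
  refine (abs_sub _ _).trans (add_le_add ?_ (h3.trans ?_))
  · rw [abs_mul, abs_of_nonneg (by positivity)]
    have hρ0 := M.rhoL_nonneg C l
    have hρ := M.rhoL_le_rho0 C l
    refine mul_le_mul hn0 (h1.trans ?_) (abs_nonneg _) (by positivity)
    have := pow_nonneg (hρ0.trans hρ) Tc
    gcongr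
  · gcongr

theorem oracle_apply (M : NetworkedMDP N d S A) (C : M.Cluster → Matrix (Fin N) (Fin N) ℝ)
    (δ : ℝ) (Te Tc : ℕ) (u : Param d) (ω : ℕ → (∀ i, S i) × (∀ i, A i)) (p : Σ i, Fin (d i)) :
    M.oracle C δ Te Tc u ω p =
      (M.nl (M.cluster p.1) * M.consensus C Te Tc (M.cluster p.1) ω p.1 / δ) * u p := rfl

theorem norm_oracle_le (M : NetworkedMDP N d S A) {C : M.Cluster → Matrix (Fin N) (Fin N) ℝ}
    (hC : M.IsConsensusWeights C) {J0 : ℝ} (hJ : 0 ≤ J0)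
    (hb : ∀ i x, |M.reward i x| ≤ J0 * (1 - M.γ)) {δ : ℝ} (hδ : 0 < δ)
    (Te Tc : ℕ) (u : Param d) (ω : ℕ → (∀ i, S i) × (∀ i, A i)) :
    ‖M.oracle C δ Te Tc u ω‖ ≤ M.n0 * J0 / δ * ‖u‖ := by
  refine le_of_sq_le_sq ?_ (by positivity)
  rw [EuclideanSpace.real_norm_sq_eq, mul_pow, EuclideanSpace.real_norm_sq_eq, Finset.mul_sum]
  refine Finset.sum_le_sum fun p _ => ?_
  rw [oracle_apply, mul_pow]
  refine mul_le_mul_of_nonneg_right ?_ (sq_nonneg _)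
  rw [← sq_abs, abs_div, abs_mul, abs_of_pos hδ, abs_of_nonneg (Nat.cast_nonneg _)]
  have h1 : (M.nl (M.cluster p.1) : ℝ) ≤ M.n0 := by exact_mod_cast M.nl_le_n0 _
  have h2 := M.consensus_abs_le hC hb Te Tc _ ω ⟨p.1, M.self_mem_Icl p.1⟩
  simp only at h2
  gcongr

theorem integrable_oracle (M : NetworkedMDP N d S A) {C : M.Cluster → Matrix (Fin N) (Fin N) ℝ}
    (hC : M.IsConsensusWeights C) {J0 : ℝ} (hJ : 0 ≤ J0)
    (hb : ∀ i x, |M.reward i x| ≤ J0 * (1 - M.γ)) {δ : ℝ} (hδ : 0 < δ)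
    (Te Tc : ℕ) (θ : Param d) :
    Integrable (fun x => M.oracle C δ Te Tc x.1 x.2) (M.epochKernel δ θ) :=
  (M.integrable_epochKernel_of_fst δ θ
    (integrable_norm_stdGaussian.const_mul (M.n0 * J0 / δ))).mono'
    (M.measurable_oracle C δ Te Tc).aestronglyMeasurable
    (ae_of_all _ fun x => M.norm_oracle_le hC hJ hb hδ Te Tc x.1 x.2)

theorem integrable_norm_oracle_sq (M : NetworkedMDP N d S A)
    {C : M.Cluster → Matrix (Fin N) (Fin N) ℝ}
    (hC : M.IsConsensusWeights C) {J0 : ℝ} (hJ : 0 ≤ J0)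
    (hb : ∀ i x, |M.reward i x| ≤ J0 * (1 - M.γ)) {δ : ℝ} (hδ : 0 < δ)
    (Te Tc : ℕ) (θ : Param d) :
    Integrable (fun x => ‖M.oracle C δ Te Tc x.1 x.2‖ ^ 2) (M.epochKernel δ θ) := by
  refine (M.integrable_epochKernel_of_fst δ θ
    (integrable_norm_sq_stdGaussian.const_mul ((M.n0 * J0 / δ) ^ 2))).mono'
    ((M.measurable_oracle C δ Te Tc).norm.pow_const 2).aestronglyMeasurable
    (ae_of_all _ fun x => ?_)
  rw [Real.norm_of_nonneg (by positivity), ← mul_pow]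
  exact pow_le_pow_left₀ (norm_nonneg _) (M.norm_oracle_le hC hJ hb hδ Te Tc x.1 x.2) 2

/-- The bias of the zeroth-order oracle. -/
theorem abs_integral_inner_oracle_sub_le (M : NetworkedMDP N d S A)
    {C : M.Cluster → Matrix (Fin N) (Fin N) ℝ} (hC : M.IsConsensusWeights C) {J0 c : ℝ}
    (hJ : 0 ≤ J0) (hb : ∀ i x, |M.reward i x| ≤ J0 * (1 - M.γ)) {δ : ℝ} (hδ : 0 < δ)
    (Te Tc : ℕ) (hc0 : 0 ≤ c)
    (hc : ∀ (l : M.Cluster) ω (i : M.Icl l),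
      |M.nl l * M.consensus C Te Tc l ω i - ∑ j ∈ M.Icl l, M.gain j ω| ≤ c)
    (θ v : Param d) :
    |∫ x, inner ℝ v (M.oracle C δ Te Tc x.1 x.2) ∂(M.epochKernel δ θ) -
      inner ℝ v (gradient (M.Jsmooth δ) θ)| ≤ c / δ * √(∑ i, d i : ℕ) * ‖v‖ := by
  -- `mean i` is the expected scalar weight used by agent i and `H i` the weight that would give the
  -- exact gradient; they differ by at most c at every parameter.
  let mean : Fin N → Param d → ℝ := fun i θ =>
    ∫ ω, M.nl (M.cluster i) * M.consensus C Te Tc (M.cluster i) ω i ∂(M.epKernel θ)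
  let H : Fin N → Param d → ℝ := fun i θ => ∑ j ∈ M.Icl (M.cluster i), M.localJ j θ
  have hcm : ∀ i : Fin N, Measurable fun ω =>
      M.nl (M.cluster i) * M.consensus C Te Tc (M.cluster i) ω i := fun i =>
    (M.measurable_consensus C Te Tc _ i).const_mul _
  have hcb : ∀ (i : Fin N) ω, |M.nl (M.cluster i) * M.consensus C Te Tc (M.cluster i) ω i| ≤
      M.nl (M.cluster i) * J0 := fun i ω => by
    rw [abs_mul, abs_of_nonneg (Nat.cast_nonneg _)]
    exact mul_le_mul_of_nonneg_left
      (M.consensus_abs_le hC hb Te Tc _ ω ⟨i, M.self_mem_Icl i⟩) (Nat.cast_nonneg _)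
  have hmean_m : ∀ i, Measurable (mean i) := fun i => measurable_integral_kernel _ (hcm i)
  have hmean_b : ∀ i θ, |mean i θ| ≤ M.nl (M.cluster i) * J0 := fun i θ =>
    abs_integral_le_of_abs_le (hcb i)
  have hH_m : ∀ i, Measurable (H i) := fun i =>
    Finset.measurable_fun_sum _ fun j _ => M.measurable_localJ j (hb j)
  have hH_b : ∀ i θ, |H i θ| ≤ M.nl (M.cluster i) * J0 := fun i θ => by
    refine (Finset.abs_sum_le_sum_abs _ _).trans
      ((Finset.sum_le_sum fun j _ => M.abs_localJ_le j (hb j) θ).trans ?_)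
    rw [Finset.sum_const, nsmul_eq_mul, nl]
  have hdiff : ∀ i θ, |mean i θ - H i θ| ≤ c := fun i θ => by
    have hg : ∀ j, Integrable (M.gain j) (M.epKernel θ) := fun j =>
      integrable_of_abs_le (M.measurable_gain j (hb j)) (M.abs_gain_le j (hb j))
    have : mean i θ - H i θ = ∫ ω, (M.nl (M.cluster i) * M.consensus C Te Tc (M.cluster i) ω i -
        ∑ j ∈ M.Icl (M.cluster i), M.gain j ω) ∂(M.epKernel θ) := by
      rw [integral_sub (integrable_of_abs_le (hcm i) (hcb i))
        (integrable_finsetSum _ fun j _ => hg j), integral_finsetSum _ fun j _ => hg j]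
      rfl
    rw [this]
    exact abs_integral_le_of_abs_le fun ω => hc _ ω ⟨i, M.self_mem_Icl i⟩
  have h1 : ∫ x, inner ℝ v (M.oracle C δ Te Tc x.1 x.2) ∂(M.epochKernel δ θ) =
      ∫ u, ∑ p : Σ i, Fin (d i), v p * (mean p.1 (θ + δ • u) / δ * u p)
        ∂(stdGaussian (Param d)) := by
    rw [M.integral_epochKernel δ θ ((M.integrable_oracle hC hJ hb hδ Te Tc θ).const_inner v)]
    refine integral_congr_ae (ae_of_all _ fun u => ?_)
    simp only [PiLp.inner_apply, RCLike.inner_apply, conj_trivial, oracle_apply]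
    have hi : ∀ p : Σ i, Fin (d i), Integrable (fun ω =>
        M.nl (M.cluster p.1) * M.consensus C Te Tc (M.cluster p.1) ω p.1 / δ * u p * v p)
        (M.epKernel (θ + δ • u)) := fun p =>
      (((integrable_of_abs_le (hcm p.1) (hcb p.1)).div_const δ).mul_const _).mul_const _
    rw [integral_finsetSum _ fun p _ => hi p]
    refine Finset.sum_congr rfl fun p _ => ?_
    rw [integral_mul_const, integral_mul_const, integral_div]
    ring
  have hi1 : ∀ p : Σ i, Fin (d i), Integrable (fun u => v p * (mean p.1 (θ + δ • u) / δ * u p))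
      (stdGaussian (Param d)) := fun p =>
    (integrable_shift_mul_apply δ θ (hmean_m p.1) (hmean_b p.1) p).const_mul _
  have hi2 : ∀ p : Σ i, Fin (d i), Integrable (fun u => v p * (H p.1 (θ + δ • u) / δ * u p))
      (stdGaussian (Param d)) := fun p =>
    (integrable_shift_mul_apply δ θ (hH_m p.1) (hH_b p.1) p).const_mul _
  have h2 : inner ℝ v (gradient (M.Jsmooth δ) θ) =
      ∫ u, ∑ p : Σ i, Fin (d i), v p * (H p.1 (θ + δ • u) / δ * u p)
        ∂(stdGaussian (Param d)) := by
    rw [integral_finsetSum _ fun p _ => hi2 p]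
    simp only [PiLp.inner_apply, RCLike.inner_apply, conj_trivial,
      M.gradient_Jsmooth_apply hb hδ, integral_const_mul]
    exact Finset.sum_congr rfl fun p _ => mul_comm _ _
  rw [h1, h2, ← integral_sub (integrable_finsetSum _ fun p _ => hi1 p)
    (integrable_finsetSum _ fun p _ => hi2 p)]
  have h3 : ∀ u : Param d, ‖∑ p : Σ i, Fin (d i), v p * (mean p.1 (θ + δ • u) / δ * u p) -
      ∑ p : Σ i, Fin (d i), v p * (H p.1 (θ + δ • u) / δ * u p)‖ ≤ c / δ * ‖v‖ * ‖u‖ := by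
    intro u
    -- Collecting the errors into one vector whose coordinates are those of u scaled by at most c/δ
    -- allows a single Cauchy–Schwarz step, with no further loss in the dimension.
    let w : Param d := WithLp.toLp 2 fun p =>
      (mean p.1 (θ + δ • u) - H p.1 (θ + δ • u)) / δ * u p
    have hw : ‖w‖ ≤ c / δ * ‖u‖ := by
      refine le_of_sq_le_sq ?_ (by positivity)
      rw [EuclideanSpace.real_norm_sq_eq, mul_pow, EuclideanSpace.real_norm_sq_eq, Finset.mul_sum]
      refine Finset.sum_le_sum fun p _ => ?_
      simp only [w, mul_pow]
      refine mul_le_mul_of_nonneg_right ?_ (sq_nonneg _)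
      rw [← sq_abs, abs_div, abs_of_pos hδ]
      have := hdiff p.1 (θ + δ • u)
      gcongr
    have he : ∑ p : Σ i, Fin (d i), v p * (mean p.1 (θ + δ • u) / δ * u p) -
        ∑ p : Σ i, Fin (d i), v p * (H p.1 (θ + δ • u) / δ * u p) = inner ℝ v w := by
      rw [← Finset.sum_sub_distrib]
      simp only [PiLp.inner_apply, RCLike.inner_apply, conj_trivial, w]
      exact Finset.sum_congr rfl fun p _ => by ring
    rw [he]
    refine (norm_inner_le_norm v w).trans ((mul_le_mul_of_nonneg_left hw (norm_nonneg v)).trans_eq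
      (by ring))
  refine (norm_integral_le_of_norm_le (integrable_norm_stdGaussian.const_mul (c / δ * ‖v‖))
    (ae_of_all _ h3)).trans ?_
  rw [integral_const_mul]
  have h4 : ∫ u, ‖u‖ ∂(stdGaussian (Param d)) ≤ √(∑ i, d i : ℕ) :=
    integral_norm_stdGaussian_le.trans_eq (by simp)
  calc c / δ * ‖v‖ * ∫ u, ‖u‖ ∂(stdGaussian (Param d)) ≤ c / δ * ‖v‖ * √(∑ i, d i : ℕ) := by
        gcongr
    _ = _ := by ring

/-- Jensen's inequality along a stochastic row reduces the estimate to single returns, whose second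
moment is variance plus squared mean. -/
theorem integral_consensus_sq_le (M : NetworkedMDP N d S A)
    {C : M.Cluster → Matrix (Fin N) (Fin N) ℝ} (hC : M.IsConsensusWeights C) {J0 q : ℝ}
    (hb : ∀ i x, |M.reward i x| ≤ J0 * (1 - M.γ)) (Te Tc : ℕ)
    (hvar : ∀ i θ, Var[M.W Te i; M.epKernel θ] ≤ q) (l : M.Cluster) (i : M.Icl l) (θ : Param d) :
    ∫ ω, M.consensus C Te Tc l ω i ^ 2 ∂(M.epKernel θ) ≤ q + J0 ^ 2 := by
  have hJ : 0 ≤ J0 := by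
    have : Nonempty (ℕ → (∀ i, S i) × (∀ i, A i)) :=
      nonempty_of_isProbabilityMeasure (M.epKernel θ)
    exact (abs_nonneg _).trans (M.abs_W_le Te i (hb i) this.some)
  have hP := pow_mem (hC.doublyStochastic l) Tc
  have hWi : ∀ j, Integrable (fun ω => M.W Te j ω ^ 2) (M.epKernel θ) := fun j =>
    integrable_of_abs_le (c := J0 ^ 2) ((M.measurable_W Te j).pow_const 2) fun ω => by
      rw [abs_pow]
      exact pow_le_pow_left₀ (abs_nonneg _) (M.abs_W_le Te j (hb j) ω) 2
  have hW : ∀ j, ∫ ω, M.W Te j ω ^ 2 ∂(M.epKernel θ) ≤ q + J0 ^ 2 := fun j => by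
    have hL : MemLp (M.W Te j) 2 (M.epKernel θ) :=
      MemLp.of_bound (M.measurable_W Te j).aestronglyMeasurable J0
        (ae_of_all _ (M.abs_W_le Te j (hb j)))
    have h1 := variance_eq_sub hL
    have h2 := hvar j θ
    have h3 : |∫ ω, M.W Te j ω ∂(M.epKernel θ)| ≤ J0 :=
      abs_integral_le_of_abs_le (M.abs_W_le Te j (hb j))
    have h4 := sq_le_sq' (abs_le.1 h3).1 (abs_le.1 h3).2
    simp only [Pi.pow_apply] at h1
    linarith
  calc _ ≤ ∫ ω, ∑ j : M.Icl l, ((M.C0 C l) ^ Tc) i j * M.W Te j ω ^ 2 ∂(M.epKernel θ) := by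
        refine integral_mono ?_ (integrable_finsetSum _ fun j _ => (hWi j).const_mul _)
          fun ω => M.consensus_sq_le hC Te Tc l ω i
        refine integrable_of_abs_le (c := J0 ^ 2)
          ((M.measurable_consensus C Te Tc l i).pow_const 2) fun ω => ?_
        rw [abs_pow]
        exact pow_le_pow_left₀ (abs_nonneg _) (M.consensus_abs_le hC hb Te Tc l ω i) 2
    _ = ∑ j : M.Icl l, ((M.C0 C l) ^ Tc) i j * ∫ ω, M.W Te j ω ^ 2 ∂(M.epKernel θ) := by
        rw [integral_finsetSum _ fun (j : M.Icl l) _ => (hWi j).const_mul _]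
        simp_rw [integral_const_mul]
    _ ≤ ∑ j : M.Icl l, ((M.C0 C l) ^ Tc) i j * (q + J0 ^ 2) :=
        Finset.sum_le_sum fun j _ => mul_le_mul_of_nonneg_left (hW j)
          (nonneg_of_mem_doublyStochastic hP)
    _ = _ := by rw [← Finset.sum_mul, sum_row_of_mem_doublyStochastic hP, one_mul]

theorem integral_norm_oracle_sq_le (M : NetworkedMDP N d S A)
    {C : M.Cluster → Matrix (Fin N) (Fin N) ℝ} (hC : M.IsConsensusWeights C) {J0 q : ℝ}
    (hJ : 0 ≤ J0) (hb : ∀ i x, |M.reward i x| ≤ J0 * (1 - M.γ)) {δ : ℝ} (hδ : 0 < δ) (Te Tc : ℕ)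
    (hvar : ∀ i θ, Var[M.W Te i; M.epKernel θ] ≤ q) (θ : Param d) :
    ∫ x, ‖M.oracle C δ Te Tc x.1 x.2‖ ^ 2 ∂(M.epochKernel δ θ) ≤
      M.n0 ^ 2 * (q + J0 ^ 2) / δ ^ 2 * (∑ i, d i : ℕ) := by
  have hint := M.integrable_norm_oracle_sq hC hJ hb hδ Te Tc θ
  rw [M.integral_epochKernel δ θ hint]
  -- The trajectory depends on u, but the second-moment bound is uniform in the parameter, so
  -- integrating over the trajectory first decouples the two.
  have hle : ∀ u : Param d,
      ∫ ω, ‖M.oracle C δ Te Tc u ω‖ ^ 2 ∂(M.epKernel (θ + δ • u)) ≤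
        M.n0 ^ 2 * (q + J0 ^ 2) / δ ^ 2 * ‖u‖ ^ 2 := by
    intro u
    simp only [EuclideanSpace.real_norm_sq_eq, oracle_apply]
    have he : ∀ (p : Σ i, Fin (d i)) (ω : ℕ → (∀ i, S i) × (∀ i, A i)),
        (M.nl (M.cluster p.1) * M.consensus C Te Tc (M.cluster p.1) ω p.1 / δ * u p) ^ 2 =
        ((M.nl (M.cluster p.1) : ℝ) ^ 2 / δ ^ 2 * u p ^ 2) *
          M.consensus C Te Tc (M.cluster p.1) ω p.1 ^ 2 := fun p ω => by ring
    simp_rw [he]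
    rw [integral_finsetSum, Finset.mul_sum]
    · refine Finset.sum_le_sum fun p _ => ?_
      rw [integral_const_mul]
      have h1 := M.integral_consensus_sq_le hC hb Te Tc hvar (M.cluster p.1)
        ⟨p.1, M.self_mem_Icl p.1⟩ (θ + δ • u)
      have h2 : (M.nl (M.cluster p.1) : ℝ) ≤ M.n0 := by exact_mod_cast M.nl_le_n0 _
      calc _ ≤ ((M.n0 : ℝ) ^ 2 / δ ^ 2 * u p ^ 2) * (q + J0 ^ 2) := by
            refine mul_le_mul ?_ h1 (integral_nonneg fun _ => sq_nonneg _) (by positivity)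
            gcongr
        _ = _ := by ring
    · intro p _
      refine Integrable.const_mul (integrable_of_abs_le (c := J0 ^ 2)
        ((M.measurable_consensus C Te Tc _ _).pow_const 2) fun ω => ?_) _
      rw [abs_pow]
      exact pow_le_pow_left₀ (abs_nonneg _)
        (M.consensus_abs_le hC hb Te Tc _ ω ⟨p.1, M.self_mem_Icl p.1⟩) 2
  rw [epochKernel] at hint
  refine (integral_mono hint.integral_compProd
    (integrable_norm_sq_stdGaussian.const_mul _) hle).trans_eq ?_
  rw [integral_const_mul, Kernel.const_apply, integral_norm_sq_stdGaussian]
  simp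

end NetworkedMDP

/-! ### Expected ascent per epoch and its summation. -/

theorem integrable_add_mul_sub_mul {Ω : Type*} [MeasurableSpace Ω] {μ : Measure Ω} {f g h : Ω → ℝ}
    (hf : Integrable f μ) (hg : Integrable g μ) (hh : Integrable h μ) (a b : ℝ) :
    Integrable (fun x => f x + a * g x - b * h x) μ :=
  (hf.add (hg.const_mul a)).sub (hh.const_mul b)

theorem integral_add_mul_sub_mul {Ω : Type*} [MeasurableSpace Ω] {μ : Measure Ω} {f g h : Ω → ℝ}
    (hf : Integrable f μ) (hg : Integrable g μ) (hh : Integrable h μ) (a b : ℝ) :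
    ∫ x, (f x + a * g x - b * h x) ∂μ = ∫ x, f x ∂μ + a * ∫ x, g x ∂μ - b * ∫ x, h x ∂μ := by
  rw [integral_sub (f := fun x => f x + a * g x) (hf.add (hg.const_mul a)) (hh.const_mul b),
    integral_add hf (hg.const_mul a), integral_const_mul, integral_const_mul]

namespace NetworkedMDP

variable {N : ℕ} {d : Fin N → ℕ} {S A : Fin N → Type*}
  [∀ i, MeasurableSpace (S i)] [∀ i, MeasurableSpace (A i)]

theorem measurable_iterate (M : NetworkedMDP N d S A)
    (C : M.Cluster → Matrix (Fin N) (Fin N) ℝ) (δ η : ℝ) (Te Tc : ℕ) :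
    Measurable fun x : Param d × (Param d × (ℕ → (∀ i, S i) × (∀ i, A i))) =>
      x.1 + η • M.oracle C δ Te Tc x.2.1 x.2.2 :=
  measurable_fst.add (((M.measurable_oracle C δ Te Tc).comp measurable_snd).const_smul η)

theorem isProbabilityMeasure_iterLaw (M : NetworkedMDP N d S A)
    (C : M.Cluster → Matrix (Fin N) (Fin N) ℝ) (δ η : ℝ) (Te Tc : ℕ) (θ₀ : Param d) (k : ℕ) :
    IsProbabilityMeasure (M.iterLaw C δ η Te Tc θ₀ k) := by
  induction k with
  | zero => unfold iterLaw; infer_instance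
  | succ k ih =>
    unfold iterLaw
    exact Measure.isProbabilityMeasure_map (M.measurable_iterate C δ η Te Tc).aemeasurable

theorem integral_iterLaw_succ (M : NetworkedMDP N d S A)
    (C : M.Cluster → Matrix (Fin N) (Fin N) ℝ) (δ η : ℝ) (Te Tc : ℕ) (θ₀ : Param d) (k : ℕ)
    {f : Param d → ℝ} (hf : Measurable f) {c : ℝ} (hc : ∀ θ, |f θ| ≤ c) :
    ∫ θ, f θ ∂(M.iterLaw C δ η Te Tc θ₀ (k + 1)) =
      ∫ θ, ∫ x, f (θ + η • M.oracle C δ Te Tc x.1 x.2) ∂(M.epochKernel δ θ)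
        ∂(M.iterLaw C δ η Te Tc θ₀ k) := by
  have := M.isProbabilityMeasure_iterLaw C δ η Te Tc θ₀ k
  have hm := M.measurable_iterate C δ η Te Tc
  rw [iterLaw, integral_map hm.aemeasurable hf.aestronglyMeasurable,
    Measure.integral_compProd]
  exact integrable_of_abs_le (hf.comp hm) fun x => hc _

theorem integrable_integral_iterate (M : NetworkedMDP N d S A)
    (C : M.Cluster → Matrix (Fin N) (Fin N) ℝ) (δ η : ℝ) (Te Tc : ℕ) (μ : Measure (Param d))
    [IsProbabilityMeasure μ] {f : Param d → ℝ} (hf : Measurable f) {c : ℝ}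
    (hc : ∀ θ, |f θ| ≤ c) :
    Integrable (fun θ => ∫ x, f (θ + η • M.oracle C δ Te Tc x.1 x.2) ∂(M.epochKernel δ θ)) μ := by
  refine integrable_of_abs_le (c := c) ?_ fun θ => abs_integral_le_of_abs_le fun x => hc _
  exact (StronglyMeasurable.integral_kernel_prod_right (κ := M.epochKernel δ)
    (f := fun θ x => f (θ + η • M.oracle C δ Te Tc x.1 x.2))
    (hf.comp (M.measurable_iterate C δ η Te Tc)).stronglyMeasurable).measurable

/-- Expected increase of a function with Lipschitz gradient in one learning epoch. -/
theorem le_integral_epochKernel (M : NetworkedMDP N d S A)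
    {C : M.Cluster → Matrix (Fin N) (Fin N) ℝ} (hC : M.IsConsensusWeights C) {J0 : ℝ}
    (hJ : 0 ≤ J0) (hb : ∀ i x, |M.reward i x| ≤ J0 * (1 - M.γ)) {δ : ℝ} (hδ : 0 < δ)
    {η : ℝ} (hη : 0 ≤ η) (Te Tc : ℕ) {G : Param d → ℝ} (hG : Differentiable ℝ G) {c : ℝ}
    (hGc : ∀ θ, |G θ| ≤ c) {Λ : ℝ} (hΛ0 : 0 ≤ Λ)
    (hΛ : ∀ x y, ‖gradient G x - gradient G y‖ ≤ Λ * ‖x - y‖) {β Q ε : ℝ} (θ : Param d)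
    (hβ : |∫ x, inner ℝ (gradient G θ) (M.oracle C δ Te Tc x.1 x.2) ∂(M.epochKernel δ θ) -
      inner ℝ (gradient G θ) (gradient G θ)| ≤ β * ‖gradient G θ‖)
    (hβε : 4 * β ^ 2 ≤ ε)
    (hQ : ∫ x, ‖M.oracle C δ Te Tc x.1 x.2‖ ^ 2 ∂(M.epochKernel δ θ) ≤ Q) :
    G θ + η * (3 / 4 * ‖gradient G θ‖ ^ 2 - ε / 4) - Λ / 2 * η ^ 2 * Q ≤
      ∫ x, G (θ + η • M.oracle C δ Te Tc x.1 x.2) ∂(M.epochKernel δ θ) := by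
  have hi1 : Integrable (fun x => inner ℝ (gradient G θ) (M.oracle C δ Te Tc x.1 x.2))
      (M.epochKernel δ θ) := (M.integrable_oracle hC hJ hb hδ Te Tc θ).const_inner _
  have hi2 := M.integrable_norm_oracle_sq hC hJ hb hδ Te Tc θ
  have hi3 : Integrable (fun x => G (θ + η • M.oracle C δ Te Tc x.1 x.2)) (M.epochKernel δ θ) :=
    integrable_of_abs_le (hG.continuous.measurable.comp
      (((M.measurable_oracle C δ Te Tc).const_smul η).const_add θ)) fun x => hGc _
  have hpt : ∀ x : Param d × (ℕ → (∀ i, S i) × (∀ i, A i)),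
      G θ + η * inner ℝ (gradient G θ) (M.oracle C δ Te Tc x.1 x.2) -
        Λ / 2 * η ^ 2 * ‖M.oracle C δ Te Tc x.1 x.2‖ ^ 2 ≤
      G (θ + η • M.oracle C δ Te Tc x.1 x.2) := fun x => by
    have := le_of_lipschitz_gradient hG hΛ θ (η • M.oracle C δ Te Tc x.1 x.2)
    rw [inner_smul_right, norm_smul, mul_pow, Real.norm_of_nonneg hη, ← mul_assoc] at this
    exact this
  have hmono := integral_mono (integrable_add_mul_sub_mul (integrable_const (G θ)) hi1 hi2 η
    (Λ / 2 * η ^ 2)) hi3 hpt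
  rw [integral_add_mul_sub_mul (integrable_const (G θ)) hi1 hi2] at hmono
  simp only [integral_const, probReal_univ, one_smul] at hmono
  rw [real_inner_self_eq_norm_sq] at hβ
  have h1 := (abs_le.1 hβ).1
  -- Young's inequality β‖∇‖ ≤ ‖∇‖²/4 + β², together with β² ≤ ε/4.
  have h2 : 3 / 4 * ‖gradient G θ‖ ^ 2 - ε / 4 ≤
      ∫ x, inner ℝ (gradient G θ) (M.oracle C δ Te Tc x.1 x.2) ∂(M.epochKernel δ θ) := by
    nlinarith [sq_nonneg (‖gradient G θ‖ - 2 * β)]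
  have h3 := mul_le_mul_of_nonneg_left h2 hη
  have h4 := mul_le_mul_of_nonneg_left hQ (by positivity : 0 ≤ Λ / 2 * η ^ 2)
  linarith

/-- Summing the expected increases over the learning epochs. -/
theorem sum_integral_norm_gradient_sq_le (M : NetworkedMDP N d S A)
    {C : M.Cluster → Matrix (Fin N) (Fin N) ℝ} {δ η : ℝ} {Te Tc : ℕ} {G : Param d → ℝ}
    (hG : Differentiable ℝ G) {c U : ℝ} (hGc : ∀ θ, |G θ| ≤ c) (hGU : ∀ θ, G θ ≤ U) {ε R : ℝ}
    (hint : ∀ (μ : Measure (Param d)) [IsProbabilityMeasure μ],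
      Integrable (fun θ => ‖gradient G θ‖ ^ 2) μ)
    (hstep : ∀ θ, G θ + η * (3 / 4 * ‖gradient G θ‖ ^ 2 - ε / 4) - R ≤
      ∫ x, G (θ + η • M.oracle C δ Te Tc x.1 x.2) ∂(M.epochKernel δ θ))
    (θ₀ : Param d) (K : ℕ) :
    η * (3 / 4) * ∑ k ∈ Finset.range K,
        ∫ θ, ‖gradient G θ‖ ^ 2 ∂(M.iterLaw C δ η Te Tc θ₀ k) ≤
      U - G θ₀ + K * (η * ε / 4 + R) := by
  have hprob := M.isProbabilityMeasure_iterLaw C δ η Te Tc θ₀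
  have hGi : ∀ (μ : Measure (Param d)) [IsProbabilityMeasure μ], Integrable G μ := fun μ _ =>
    integrable_of_abs_le hG.continuous.measurable hGc
  -- The expectation of G at the last iterate is kept so that the sum telescopes; it is replaced by
  -- U only at the end.
  have hk : ∀ K : ℕ, η * (3 / 4) * ∑ k ∈ Finset.range K,
        ∫ θ, ‖gradient G θ‖ ^ 2 ∂(M.iterLaw C δ η Te Tc θ₀ k) ≤
      ∫ θ, G θ ∂(M.iterLaw C δ η Te Tc θ₀ K) - G θ₀ + K * (η * ε / 4 + R) := by
    intro K
    induction K with
    | zero => simp [iterLaw]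
    | succ k ih =>
      have := hprob k
      have h1 := M.integral_iterLaw_succ C δ η Te Tc θ₀ k hG.continuous.measurable hGc
      have hi := hint (M.iterLaw C δ η Te Tc θ₀ k)
      have h2 := integral_mono (integrable_add_mul_sub_mul (hGi _) hi (integrable_const (1 : ℝ))
          (η * (3 / 4)) (η * ε / 4 + R))
        (M.integrable_integral_iterate C δ η Te Tc (M.iterLaw C δ η Te Tc θ₀ k)
          hG.continuous.measurable hGc) fun θ => (by linarith [hstep θ])
      rw [integral_add_mul_sub_mul (hGi _) hi (integrable_const (1 : ℝ))] at h2
      simp only [integral_const, probReal_univ, one_smul] at h2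
      rw [Finset.sum_range_succ, h1]
      push_cast
      linarith
  have h3 : ∫ θ, G θ ∂(M.iterLaw C δ η Te Tc θ₀ K) ≤ U := by
    have := hprob K
    simpa using integral_mono (hGi (M.iterLaw C δ η Te Tc θ₀ K)) (integrable_const U) hGU
  linarith [hk K]

end NetworkedMDP

/-! ### Choice of the constants and the main theorem. -/

theorem pow_le_of_logb_le {b x : ℝ} (hb : 0 < b) (hb1 : b < 1) (hx : 0 < x) {n : ℕ}
    (h : Real.logb b x ≤ n) : b ^ n ≤ x := by
  rw [← Real.rpow_natCast]
  exact (Real.logb_le_iff_le_rpow_of_base_lt_one hb hb1 hx).1 h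

theorem rpow_three_halves {x : ℝ} (hx : 0 ≤ x) : x ^ (3 / 2 : ℝ) = √x ^ 3 := by
  rw [Real.sqrt_eq_rpow, ← Real.rpow_natCast, ← Real.rpow_mul hx]
  norm_num

/-- The bias terms of the oracle, for `e = √ε` and `D = √d`. -/
theorem bias_sq_le {e D L n J0 b g ρ δ : ℝ} (he : 0 < e) (hD : 0 < D) (hL : 0 < L) (hn : 1 ≤ n)
    (hJ0 : 0 ≤ J0) (hb : 0 ≤ b) (hbJ : b ≤ J0) (hg0 : 0 ≤ g) (hρ0 : 0 ≤ ρ)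
    (hδ : δ = e ^ 2 / (L * D))
    (hg : 0 < J0 → g ≤ e ^ 3 / (2 * √2 * n ^ 2 * L * D ^ 2 * J0))
    (hρ : 0 < J0 → ρ ≤ e ^ 3 / (2 * √2 * n ^ 2 * L * D ^ 2 * (2 * b + J0))) :
    4 * ((n * (ρ * (√n * b)) + n * (g * J0)) / δ * D) ^ 2 ≤ e ^ 2 := by
  rcases hJ0.eq_or_lt with h0 | hpos
  · have hb0 : b = 0 := le_antisymm (h0 ▸ hbJ) hb
    rw [← h0, hb0]
    simpa using sq_nonneg e
  have h2 : 0 < √2 := Real.sqrt_pos.2 (by norm_num)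
  have h22 : √2 ^ 2 = 2 := Real.sq_sqrt (by norm_num)
  have hn0 : 0 < n := by linarith
  have h1 : n * (g * J0) * (2 * √2 * L * D ^ 2) ≤ e ^ 3 := by
    have := (le_div_iff₀ (by positivity)).1 (hg hpos)
    have hnn : n ≤ n ^ 2 := by nlinarith
    refine le_trans ?_ this
    calc n * (g * J0) * (2 * √2 * L * D ^ 2) ≤ n ^ 2 * (g * J0) * (2 * √2 * L * D ^ 2) := by gcongr
      _ = _ := by ring
  have h3 : n * (ρ * (√n * b)) * (2 * √2 * L * D ^ 2) ≤ e ^ 3 / 3 := by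
    have := (le_div_iff₀ (by positivity)).1 (hρ hpos)
    have hs : √n ≤ n := by
      rw [Real.sqrt_le_left hn0.le]; nlinarith
    -- As b is half the range of returns and b ≤ J0, mixing costs only a third of the truncation
    -- budget: the total 4/3 yields the final constant 8/9. The full range would give 5/3 and 25/18
    -- > 1.
    have hb3 : b ≤ (2 * b + J0) / 3 := by linarith
    calc n * (ρ * (√n * b)) * (2 * √2 * L * D ^ 2)
        ≤ n * (ρ * (n * ((2 * b + J0) / 3))) * (2 * √2 * L * D ^ 2) := by gcongr
      _ = ρ * (2 * √2 * n ^ 2 * L * D ^ 2 * (2 * b + J0)) / 3 := by ring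
      _ ≤ _ := by linarith
  set X := n * (ρ * (√n * b)) + n * (g * J0) with hX
  have hX0 : 0 ≤ X := by positivity
  have h4 : X * (2 * √2 * L * D ^ 2) ≤ 4 / 3 * e ^ 3 := by rw [hX, add_mul]; linarith
  have h5 : X / δ * D = X * (2 * √2 * L * D ^ 2) / (2 * √2 * e ^ 2) := by
    rw [hδ]; field_simp
  have h6 : X / δ * D ≤ 4 / 3 * e / (2 * √2) := by
    rw [h5, div_le_div_iff₀ (by positivity) (by positivity)]
    calc _ ≤ 4 / 3 * e ^ 3 * (2 * √2) := by gcongr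
      _ = _ := by ring
  have h7 : 0 ≤ X / δ * D := by rw [hδ]; positivity
  calc 4 * (X / δ * D) ^ 2 ≤ 4 * (4 / 3 * e / (2 * √2)) ^ 2 := by gcongr
    _ = 8 / 9 * e ^ 2 := by rw [div_pow, mul_pow 2, h22]; ring
    _ ≤ e ^ 2 := by nlinarith [sq_nonneg e]

/-- The choice of the step size and of the number of epochs. -/
theorem average_le {e D L n q U k δ η B X : ℝ} (he : 0 < e) (hD : 0 < D)
    (hk : 0 < k) (hδ : δ = e ^ 2 / (L * D)) (hη : η = e ^ 3 / (D ^ 3 * k))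
    (hB : 2 * U + L ^ 4 * n ^ 2 * q ≤ B) (hK : D ^ 6 * B ^ 2 / e ^ 10 ≤ k ^ 2)
    (h : η * (3 / 4) * X ≤
      U + k ^ 2 * (η * e ^ 2 / 4 + L * D / δ / 2 * η ^ 2 * (n ^ 2 * q / δ ^ 2 * D ^ 2))) :
    1 / k ^ 2 * X ≤ e ^ 2 := by
  have hBk : D ^ 3 * B ≤ e ^ 5 * k := by
    refine le_of_sq_le_sq ?_ (by positivity)
    rw [div_le_iff₀ (by positivity)] at hK
    calc (D ^ 3 * B) ^ 2 = D ^ 6 * B ^ 2 := by ring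
      _ ≤ _ := hK
      _ = _ := by ring
  -- The choices of δ and η cancel k, e and D from the quadratic term, leaving L⁴n²q/2.
  have h1 : U + k ^ 2 * (η * e ^ 2 / 4 + L * D / δ / 2 * η ^ 2 * (n ^ 2 * q / δ ^ 2 * D ^ 2)) =
      (2 * U + L ^ 4 * n ^ 2 * q) / 2 + k * e ^ 5 / (4 * D ^ 3) := by
    rw [hδ, hη]; field_simp; ring
  have h2 : B ≤ e ^ 5 * k / D ^ 3 := by rw [le_div_iff₀ (by positivity)]; linarith
  -- Half of e⁵k/D³ comes from B/2 and a quarter from the bias; the total cancels against the 3/4 on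
  -- the left.
  have h3 : η * (3 / 4) * X ≤ 3 / 4 * (e ^ 5 * k / D ^ 3) := by
    have : k * e ^ 5 / (4 * D ^ 3) = 1 / 4 * (e ^ 5 * k / D ^ 3) := by field_simp
    linarith
  have h4 : η * (3 / 4) * X = e ^ 3 * k / D ^ 3 * (3 / 4) * (1 / k ^ 2 * X) := by
    rw [hη]; field_simp
  have h5 : 3 / 4 * (e ^ 5 * k / D ^ 3) = e ^ 3 * k / D ^ 3 * (3 / 4) * e ^ 2 := by ring
  rw [h4, h5] at h3
  exact le_of_mul_le_mul_left h3 (by positivity)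

/-- Integrability is part of the conclusion because the integral of a non-integrable function is 0
by convention, which would empty the bound. For J0 = 0 both quotients are divisions by zero, so both
logarithms are 0 and the conditions hold automatically. A logarithm to base ρ₀ = 0 is also 0, whence
the separate requirement on Tc. -/
theorem theorem1 {N : ℕ} {d : Fin N → ℕ} {S A : Fin N → Type*}
    [∀ i, MeasurableSpace (S i)] [∀ i, MeasurableSpace (A i)]
    (M : NetworkedMDP N d S A)
    -- the total parameter dimension is positive
    (dim : ℕ) (hdim : dim = ∑ i, d i) (hdim_pos : 0 < dim)
    -- Lipschitz local value functions
    (Lip : Fin N → ℝ)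
    (hLip : ∀ i s θ θ', |M.V i θ s - M.V i θ' s| ≤ Lip i * ‖θ - θ'‖)
    (L : ℝ) (hL : L = ∑ i, Lip i) (hL_pos : 0 < L)
    -- bounded rewards
    (rl ru : ℝ) (hr : ∀ i x, rl ≤ M.r i x ∧ M.r i x ≤ ru)
    -- every local value-function group is connected in the communication graph
    (hconn : ∀ l, (M.Gcm.induce (M.Icl l : Set (Fin N))).Connected)
    -- doubly stochastic consensus weights
    (C : M.Cluster → Matrix (Fin N) (Fin N) ℝ) (hC : M.IsConsensusWeights C)
    -- bounds derived from the rewards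
    (Jl Ju J0 : ℝ) (hJl : Jl = rl / (1 - M.γ)) (hJu : Ju = ru / (1 - M.γ))
    (hJ0 : J0 = max |Jl| |Ju|)
    (ε δ : ℝ) (hε : 0 < ε) (hδ : δ = ε / (L * √(dim : ℝ))) :
    (∀ θ, |M.Jsmooth δ θ - M.J θ| ≤ ε) ∧
    Differentiable ℝ (M.Jsmooth δ) ∧
    ∀ (K Te Tc : ℕ) (η : ℝ) (θ₀ : Param d) (σ : Fin N → ℝ) (σ₀ B : ℝ),
      0 < K →
      η = ε ^ (3 / 2 : ℝ) / ((dim : ℝ) ^ (3 / 2 : ℝ) * √(K : ℝ)) →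
      -- variance bounds for the observed values
      (∀ i, 0 ≤ σ i) →
      (∀ i θ, Var[M.W Te i; M.epKernel θ] ≤ σ i ^ 2) →
      σ₀ = ⨆ i, σ i →
      B = 2 * (N * Ju - M.Jsmooth δ θ₀) +
        L ^ 4 * (M.n0 : ℝ) ^ 2 * (σ₀ ^ 2 + (1 + M.γ ^ Te) ^ 2 * J0 ^ 2) →
      (dim : ℝ) ^ 3 * B ^ 2 / ε ^ 5 ≤ K →
      Real.logb M.γ (ε ^ (3 / 2 : ℝ) / (2 * √2 * (M.n0 : ℝ) ^ 2 * L * dim * J0)) ≤ Te →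
      Real.logb (M.rho0 C)
        (ε ^ (3 / 2 : ℝ) / (2 * √2 * (M.n0 : ℝ) ^ 2 * L * dim * (Ju - Jl + J0))) ≤ Tc →
      -- if `ρ₀ = 0`, where the logarithm is not meaningful, one consensus step is required
      (M.rho0 C = 0 → 1 ≤ Tc) →
      (∀ k, IsProbabilityMeasure (M.iterLaw C δ η Te Tc θ₀ k)) ∧
      (∀ k, Integrable (fun θ => ‖gradient (M.Jsmooth δ) θ‖ ^ 2) (M.iterLaw C δ η Te Tc θ₀ k)) ∧
      (1 / (K : ℝ)) * ∑ k ∈ Finset.range K,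
        ∫ θ, ‖gradient (M.Jsmooth δ) θ‖ ^ 2 ∂(M.iterLaw C δ η Te Tc θ₀ k) ≤ ε := by
  classical
  have hγ := M.γ_pos
  have hγ1 : 0 < 1 - M.γ := sub_pos.2 M.γ_lt_one
  have hN : NeZero N := ⟨by rintro rfl; simp at hdim; omega⟩
  have hdim0 : (0 : ℝ) < dim := by exact_mod_cast hdim_pos
  -- In terms of √d, √ε and later √K, all fractional powers become monomials.
  obtain ⟨D, hD⟩ : ∃ D, D = √(dim : ℝ) := ⟨_, rfl⟩
  obtain ⟨e, he⟩ : ∃ e, e = √ε := ⟨_, rfl⟩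
  have hD0 : 0 < D := hD ▸ Real.sqrt_pos.2 hdim0
  have he0 : 0 < e := he ▸ Real.sqrt_pos.2 hε
  have hDsq : (dim : ℝ) = D ^ 2 := by rw [hD, Real.sq_sqrt hdim0.le]
  have hesq : ε = e ^ 2 := by rw [he, Real.sq_sqrt hε.le]
  have hDd : √((∑ i, d i : ℕ) : ℝ) = D := by rw [hD, hdim]
  have hδ' : δ = e ^ 2 / (L * D) := by rw [hδ, hesq, hD]
  have hδ0 : 0 < δ := by rw [hδ']; positivity
  have hLδ : L * δ * D = ε := by rw [hδ', hesq]; field_simp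
  have hJl' : rl = Jl * (1 - M.γ) := by rw [hJl]; field_simp
  have hJu' : ru = Ju * (1 - M.γ) := by rw [hJu]; field_simp
  have hr' : ∀ i x, rl ≤ M.reward i x ∧ M.reward i x ≤ ru := fun i x => hr i _
  have hJ0l : |Jl| ≤ J0 := hJ0 ▸ le_max_left _ _
  have hJ0u : |Ju| ≤ J0 := hJ0 ▸ le_max_right _ _
  have hJ0nn : 0 ≤ J0 := (abs_nonneg _).trans hJ0l
  have hb : ∀ i x, |M.reward i x| ≤ J0 * (1 - M.γ) := fun i x => by
    obtain ⟨h1, h2⟩ := hr' i x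
    rw [hJl'] at h1
    rw [hJu'] at h2
    have h3 := mul_le_mul_of_nonneg_right (abs_le.1 hJ0l).1 hγ1.le
    have h4 := mul_le_mul_of_nonneg_right (abs_le.1 hJ0u).2 hγ1.le
    exact abs_le.2 ⟨by linarith, by linarith⟩
  -- Centring at the midpoint supplies the half-range b = (Ju - Jl)/2 of `bias_sq_le`.
  have hm : ∀ i x, |M.reward i x - (rl + ru) / 2| ≤ (Ju - Jl) / 2 * (1 - M.γ) := fun i x => by
    obtain ⟨h1, h2⟩ := hr' i x
    have h3 : (Ju - Jl) / 2 * (1 - M.γ) = (ru - rl) / 2 := by rw [hJl', hJu']; ring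
    rw [h3]
    exact abs_le.2 ⟨by linarith, by linarith⟩
  have hJLip : ∀ θ θ', |M.J θ - M.J θ'| ≤ L * ‖θ - θ'‖ := fun θ θ' =>
    hL ▸ M.abs_J_sub_le hb hLip θ θ'
  have hdiff : Differentiable ℝ (M.Jsmooth δ) := fun θ =>
    (M.hasGradientAt_Jsmooth hb hδ0 θ).hasFDerivAt.differentiableAt
  refine ⟨fun θ => ?_, hdiff, ?_⟩
  · refine (M.abs_Jsmooth_sub_le hb hL_pos.le hJLip hδ0.le θ).trans_eq ?_
    rw [hDd, hLδ]
  intro K Te Tc η θ₀ σ σ₀ B hK hη hσ hvar hσ₀ hB hKB hTe hTc hTc0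
  have hprob := M.isProbabilityMeasure_iterLaw C δ η Te Tc θ₀
  have hΛ : ∀ x y, ‖gradient (M.Jsmooth δ) x - gradient (M.Jsmooth δ) y‖ ≤
      L * D / δ * ‖x - y‖ := fun x y =>
    hDd ▸ M.norm_gradient_Jsmooth_sub_le hb hJLip hδ0 x y
  have hgcont : Continuous (gradient (M.Jsmooth δ)) :=
    (LipschitzWith.of_dist_le_mul (K := ⟨L * D / δ, by positivity⟩) fun x y => by
      rw [dist_eq_norm, dist_eq_norm]; exact hΛ x y).continuous
  have hint : ∀ (μ : Measure (Param d)) [IsProbabilityMeasure μ],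
      Integrable (fun θ => ‖gradient (M.Jsmooth δ) θ‖ ^ 2) μ := fun μ _ => by
    refine integrable_of_abs_le (c := (N * J0 / δ * D) ^ 2) (by fun_prop) fun θ => ?_
    rw [abs_pow, abs_norm]
    exact pow_le_pow_left₀ (norm_nonneg _) (hDd ▸ M.norm_gradient_Jsmooth_le hb hδ0 θ) 2
  refine ⟨hprob, fun k => have := hprob k; hint _, ?_⟩
  -- A probability law on trajectories yields a state-action pair, and the reward there lies between
  -- rl and ru.
  have hne : Nonempty (ℕ → (∀ i, S i) × (∀ i, A i)) :=
    nonempty_of_isProbabilityMeasure (M.epKernel θ₀)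
  have hlu : rl ≤ ru := (hr' 0 (hne.some 0)).1.trans (hr' 0 (hne.some 0)).2
  have hJlu : 0 ≤ (Ju - Jl) / 2 := by
    have : Jl ≤ Ju := by rw [hJl, hJu]; gcongr
    linarith
  have hJlu' : (Ju - Jl) / 2 ≤ J0 := by linarith [(abs_le.1 hJ0l).1, (abs_le.1 hJ0u).2]
  let l₀ : M.Cluster := M.cluster 0
  have hn : (1 : ℝ) ≤ M.n0 := by exact_mod_cast (M.one_le_nl l₀).trans (M.nl_le_n0 l₀)
  have hn0 : (0 : ℝ) < M.n0 := by linarith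
  have hρ0 : 0 ≤ M.rho0 C := (M.rhoL_nonneg C l₀).trans (M.rhoL_le_rho0 C l₀)
  have hρ1 : M.rho0 C < 1 := M.rho0_lt_one hC hconn
  have h2 : 0 < √(2 : ℝ) := Real.sqrt_pos.2 (by norm_num)
  obtain ⟨k, hk⟩ : ∃ k, k = √(K : ℝ) := ⟨_, rfl⟩
  have hK0 : (0 : ℝ) < K := by exact_mod_cast hK
  have hk0 : 0 < k := hk ▸ Real.sqrt_pos.2 hK0
  have hksq : (K : ℝ) = k ^ 2 := by rw [hk, Real.sq_sqrt hK0.le]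
  have hη' : η = e ^ 3 / (D ^ 3 * k) := by
    rw [hη, rpow_three_halves hε.le, rpow_three_halves hdim0.le, ← he, ← hD, ← hk]
  have hη0 : 0 < η := by rw [hη']; positivity
  rw [rpow_three_halves hε.le, ← he, hDsq] at hTe hTc
  have hTe' : 0 < J0 → M.γ ^ Te ≤ e ^ 3 / (2 * √2 * (M.n0 : ℝ) ^ 2 * L * D ^ 2 * J0) := fun hJ =>
    pow_le_of_logb_le hγ M.γ_lt_one (by positivity) hTe
  have hTc' : 0 < J0 → M.rho0 C ^ Tc ≤
      e ^ 3 / (2 * √2 * (M.n0 : ℝ) ^ 2 * L * D ^ 2 * (2 * ((Ju - Jl) / 2) + J0)) := fun hJ => by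
    rw [show Ju - Jl + J0 = 2 * ((Ju - Jl) / 2) + J0 by ring] at hTc
    rcases hρ0.eq_or_lt with h0 | hpos
    · rw [← h0, zero_pow (by have := hTc0 h0.symm; omega)]
      positivity
    · exact pow_le_of_logb_le hpos hρ1 (by positivity) hTc
  have hbias := bias_sq_le he0 hD0 hL_pos hn hJ0nn hJlu hJlu' (pow_nonneg hγ.le Te)
    (pow_nonneg hρ0 Tc) hδ' hTe' hTc'
  have hvar' : ∀ i θ, Var[M.W Te i; M.epKernel θ] ≤ σ₀ ^ 2 := fun i θ => by
    refine (hvar i θ).trans (pow_le_pow_left₀ (hσ i) ?_ 2)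
    rw [hσ₀]
    exact le_ciSup (Set.finite_range σ).bddAbove i
  have hstep : ∀ θ, M.Jsmooth δ θ + η * (3 / 4 * ‖gradient (M.Jsmooth δ) θ‖ ^ 2 - ε / 4) -
      L * D / δ / 2 * η ^ 2 * ((M.n0 : ℝ) ^ 2 * (σ₀ ^ 2 + J0 ^ 2) / δ ^ 2 * D ^ 2) ≤
      ∫ x, M.Jsmooth δ (θ + η • M.oracle C δ Te Tc x.1 x.2) ∂(M.epochKernel δ θ) := by
    intro θ
    refine M.le_integral_epochKernel hC hJ0nn hb hδ0 hη0.le Te Tc hdiff (M.abs_Jsmooth_le hb δ)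
      (by positivity) hΛ θ ?_ (hesq ▸ hbias) ?_
    · rw [← hDd]
      refine M.abs_integral_inner_oracle_sub_le hC hJ0nn hb hδ0 Te Tc ?_
        (M.abs_consensus_sub_gain_le hC hb hm Te Tc) θ _
      have := pow_nonneg hρ0 Tc
      positivity
    · refine (M.integral_norm_oracle_sq_le hC hJ0nn hb hδ0 Te Tc hvar' θ).trans_eq ?_
      rw [← hDsq, hdim]
  have hsum := M.sum_integral_norm_gradient_sq_le hdiff (M.abs_Jsmooth_le hb δ)
    (M.Jsmooth_le hb (fun i x => (hr' i x).2) δ) hint hstep θ₀ K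
  rw [hksq, hesq, ← hJu] at hsum
  rw [hksq, hesq]
  refine average_le he0 hD0 hk0 hδ' hη' (B := B) ?_ ?_ hsum
  · rw [hB]
    -- The argument needs only J0² here; the factor in B is at least 1.
    have h1 : (1 : ℝ) ≤ (1 + M.γ ^ Te) ^ 2 :=
      one_le_pow₀ (le_add_of_nonneg_right (pow_pos hγ Te).le)
    have h3 : J0 ^ 2 ≤ (1 + M.γ ^ Te) ^ 2 * J0 ^ 2 := le_mul_of_one_le_left (sq_nonneg _) h1
    gcongr
  · rw [hDsq, hesq, hksq] at hKB
    calc _ = (D ^ 2) ^ 3 * B ^ 2 / (e ^ 2) ^ 5 := by ring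
      _ ≤ _ := hKB
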